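/- Let $\{X_n,\ n\ge 0\}$ be a birth and death chain on $\mathbb{Z}_+=\{0,1,2,\ldots\}$, i.e. a Markov chain with transition probabilities $p(x,y)$ such that $p(x,y)=0$ if and only if $|x-y|\neq 1$. Write $p_x=p(x,x+1)$ for $x\ge 0$ and $q_x=p(x,x-1)$ for $x\ge 1$; thus $p_0=1$ and $p_x,q_x>0$, $p_x+q_x=1$ for $x\ge1$. Let $\mathbb{P}_x$, $\mathbb{E}_x$ be the law and the expectation of the chain started at $x$, and let $T_x=\inf\{n\ge 1: X_n=x\}$. The state $x$ is recurrent if $\mathbb{P}_x(T_x<\infty)=1$ and positive recurrent if $\mathbb{E}_xT_x<\infty$; the chain is (positive) recurrent if every state is. A reversible law of the chain is a strictly positive probability measure $\pi$ on $\mathbb{Z}_+$ with $p(x,y)\pi(x)=p(y,x)\pi(y)$ for all $x,y$. For such $\pi$, with $Pf(x)=\sum_y p(x,y)f(y)$ and with $\langle\cdot,\cdot\rangle_\pi$, $\|\cdot\|_\pi$ the scalar product and norm of the real space $L^2(\pi)$, put $$\lambda_1=\sup\Big\{\langle Pf,f\rangle_\pi:\ f\in L^2(\pi),\ \sum_x f(x)\pi(x)=0,\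 \|f\|_\pi=1\Big\};$$ the chain has the spectral gap property if $\lambda_1<1$. (i) If $\lim_{x\to\infty}p_x=p$ and $\lim_{x\to\infty}q_x=q$ with $p<q$, then the chain is positive recurrent, it has exactly one reversible law, and it has the spectral gap property. (ii) If $p_x=\frac12-c_x$ and $q_x=\frac12+c_x$ for all $x\ge1$, where $$0<\liminf_{x\to\infty}c_xx^{\alpha}\le\limsup_{x\to\infty}c_xx^{\alpha}<+\infty \qquad (*)$$ with $\alpha\in(0,1)$, then the chain is positive recurrent, it has exactly one reversible law, and it does not have the spectral gap property. (iii) If $p_x=\frac12-c_x$ and $q_x=\frac12+c_x$ for all $x\ge1$ and $(*)$ holds with some $\alpha>1$, then the chain is recurrent, but no state is positive recurrent; in particular the chain is not positive recurrent. -/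

import Mathlib

open MeasureTheory ProbabilityTheory Filter Topology
open scoped ENNReal

namespace MarkovChain

/-- The transition probability `p(x, y)` of the chain on `ℤ₊ = ℕ` with transition kernel `P`.
On the discrete space `ℕ` a Markov kernel is the same thing as a function `p : ℕ × ℕ → [0, 1]`
with `∑ y, p(x, y) = 1` for every `x`. -/
noncomputable def transProb (P : Kernel ℕ ℕ) (x y : ℕ) : ℝ := (P x).real {y}

/-- The conditional law of `X (n + 1)` given `X 0, …, X n`: it is `P` evaluated at `X n`. -/
noncomputable def stepKernel (P : Kernel ℕ ℕ) (n : ℕ) :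
    Kernel ((_ : Finset.Iic n) → ℕ) ℕ :=
  P.comap (fun h => h ⟨n, Finset.mem_Iic.2 le_rfl⟩) (measurable_pi_apply _)

instance (P : Kernel ℕ ℕ) [IsMarkovKernel P] (n : ℕ) : IsMarkovKernel (stepKernel P n) := by
  unfold stepKernel; infer_instance

/-- The law `ℙ_x`, on the space of trajectories, of the Markov chain `(X n)` with transition
kernel `P` and initial state `X 0 = x`; here `X n` is the coordinate map `ω ↦ ω n`. -/
noncomputable def pathMeasure (P : Kernel ℕ ℕ) [IsMarkovKernel P] (x : ℕ) : Measure (ℕ → ℕ) :=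
  Kernel.traj (X := fun _ => ℕ) (stepKernel P) 0 (fun _ => x)

/-- The first return time `T_x = inf {n ≥ 1 : X n = x}`, with `inf ∅ = ∞`. -/
noncomputable def returnTime (x : ℕ) (ω : ℕ → ℕ) : ℕ∞ :=
  ⨅ n : ℕ, ⨅ _ : 1 ≤ n ∧ ω n = x, (n : ℕ∞)

/-- The state `x` is recurrent: `ℙ_x (T_x < ∞) = 1`. -/
def IsRecurrentState (P : Kernel ℕ ℕ) [IsMarkovKernel P] (x : ℕ) : Prop :=
  pathMeasure P x {ω | returnTime x ω < ⊤} = 1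

/-- The state `x` is positive recurrent: `𝔼_x T_x < ∞`. -/
def IsPositiveRecurrentState (P : Kernel ℕ ℕ) [IsMarkovKernel P] (x : ℕ) : Prop :=
  ∫⁻ ω, (returnTime x ω : ℝ≥0∞) ∂(pathMeasure P x) < ∞

/-- The chain is recurrent: every state is. -/
def IsRecurrent (P : Kernel ℕ ℕ) [IsMarkovKernel P] : Prop :=
  ∀ x, IsRecurrentState P x

/-- The chain is positive recurrent: every state is. -/
def IsPositiveRecurrent (P : Kernel ℕ ℕ) [IsMarkovKernel P] : Prop :=
  ∀ x, IsPositiveRecurrentState P x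

/-- `π` is a strictly positive probability measure on `ℕ` that is in detailed balance with `P`. -/
structure IsReversibleLaw (P : Kernel ℕ ℕ) (π : Measure ℕ) : Prop where
  isProbabilityMeasure : IsProbabilityMeasure π
  pos : ∀ x, 0 < π.real {x}
  detailedBalance : ∀ x y, transProb P x y * π.real {x} = transProb P y x * π.real {y}

/-- The transition operator `P f (x) = ∑ y, p(x, y) f(y)`. -/
noncomputable def transOp (P : Kernel ℕ ℕ) (f : ℕ → ℝ) (x : ℕ) : ℝ := ∫ y, f y ∂(P x)

/-- `λ₁ = sup {⟨P f, f⟩_π : f ∈ L²(π), ∫ f dπ = 0, ‖f‖_π = 1}`. -/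
noncomputable def lambdaOne (P : Kernel ℕ ℕ) (π : Measure ℕ) : ℝ :=
  sSup {r : ℝ | ∃ f : ℕ → ℝ, MemLp f 2 π ∧ ∫ x, f x ∂π = 0 ∧ ∫ x, f x ^ 2 ∂π = 1 ∧
    r = ∫ x, transOp P f x * f x ∂π}

/-- The chain, with reversible law `π`, has the spectral gap property: `λ₁ < 1`. -/
def HasSpectralGap (P : Kernel ℕ ℕ) (π : Measure ℕ) : Prop := lambdaOne P π < 1

/-- The probability `p_x = p(x, x + 1)` of a birth. -/
noncomputable def birthProb (P : Kernel ℕ ℕ) (x : ℕ) : ℝ := transProb P x (x + 1)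

/-- The probability `q_x = p(x, x - 1)` of a death; it is meant for `x ≥ 1` only. -/
noncomputable def deathProb (P : Kernel ℕ ℕ) (x : ℕ) : ℝ := transProb P x (x - 1)

/-- Birth and death chains: `p(x, y) = 0` iff `|x - y| ≠ 1`, and `p_0 = 1`. -/
structure IsBirthDeath (P : Kernel ℕ ℕ) : Prop where
  eq_zero_iff : ∀ x y : ℕ, transProb P x y = 0 ↔ |(x : ℤ) - (y : ℤ)| ≠ 1
  birthProb_zero : birthProb P 0 = 1

/-- `p_x = 1/2 - c_x` and `q_x = 1/2 + c_x` for `x ≥ 1`, where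
`0 < liminf c_x x ^ α ≤ limsup c_x x ^ α < ∞` (limits inferior and superior in `[-∞, ∞]`). -/
structure HasDriftOfOrder (P : Kernel ℕ ℕ) (c : ℕ → ℝ) (α : ℝ) : Prop where
  birthProb_eq : ∀ x, 1 ≤ x → birthProb P x = 1 / 2 - c x
  deathProb_eq : ∀ x, 1 ≤ x → deathProb P x = 1 / 2 + c x
  liminf_pos : 0 < liminf (fun x : ℕ => ((c x * (x : ℝ) ^ α : ℝ) : EReal)) atTop
  limsup_lt_top : limsup (fun x : ℕ => ((c x * (x : ℝ) ^ α : ℝ) : EReal)) atTop < ⊤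

end MarkovChain

/-! A birth and death chain always has a positive weight `w` in detailed balance, unique up to a
factor, and every claim is read off from `w` and the conductances `a x = birthProb P x * w x`. The
Poisson equation `W = ε + P W` off a state is solved explicitly, because after multiplication by `w`
it prescribes the increments of the flux `a y * (W (y + 1) - W y)` (`exists_poisson`). Used as
Lyapunov functions, the solutions show that `∑ w < ∞` implies positive recurrence, `∑ 1 / a = ∞`
implies recurrence, and `∑ w = ∞` excludes positive recurrence of a recurrent state.

The spectral gap depends on comparing the tail `π (x, ∞)` with `a x`. If the tail is at most a
multiple of `a`, Hardy's inequality bounds the Dirichlet form from below (`hasSpectralGap`); if no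
such multiple exists, normalised indicators of `(x, ∞)` have arbitrarily small Dirichlet form
(`not_hasSpectralGap`).

What remains is the size of `w`. In (i) it decays geometrically. In (ii) `w (x + 1) ≤ (1 - 2 / x) *
w x` eventually, so `w` is summable, but its ratios tend to `1`, so its tails dominate its terms. In
(iii) the drift is summable and `a` stays between two positive constants, so neither `w` nor `1 / a`
is summable. -/

namespace MarkovChain

/-! ### Killed chains and Lyapunov criteria for recurrence -/

section PathMeasure

variable (P : Kernel ℕ ℕ) [IsMarkovKernel P]

instance (x : ℕ) : IsProbabilityMeasure (pathMeasure P x) := by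
  unfold pathMeasure; infer_instance

/-- The Markov property at a fixed time, integrated. -/
lemma lintegral_pathMeasure_succ (x n : ℕ) {g : ((_ : Finset.Iic n) → ℕ) → ℝ≥0∞}
    (hg : Measurable g) (f : ℕ → ℝ≥0∞) :
    ∫⁻ ω, g (Preorder.frestrictLe n ω) * f (ω (n + 1)) ∂pathMeasure P x =
      ∫⁻ ω, g (Preorder.frestrictLe n ω) * ∫⁻ z, f z ∂P (ω n) ∂pathMeasure P x := by
  have hf : Measurable f := measurable_from_nat
  have hF : Measurable fun u : ((_ : Finset.Iic n) → ℕ) × ℕ => g u.1 * f u.2 :=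
    (hg.comp measurable_fst).mul (hf.comp measurable_snd)
  have key := Kernel.partialTraj_compProd_eq_map_traj (X := fun _ => ℕ) (κ := stepKernel P)
    (a := 0) (b := n) (Nat.zero_le n) (x₀ := fun _ => x)
  have hpair : Measurable fun ω : ℕ → ℕ =>
      ((Preorder.frestrictLe n ω : (_ : Finset.Iic n) → ℕ), ω (n + 1)) := by fun_prop
  have hres : Measurable fun ω : ℕ → ℕ =>
      (Preorder.frestrictLe n ω : (_ : Finset.Iic n) → ℕ) := by fun_prop
  have h1 := lintegral_map (μ := pathMeasure P x) hF hpair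
  have hin : ∀ h : (_ : Finset.Iic n) → ℕ, ∫⁻ z, g h * f z ∂stepKernel P n h =
      g h * ∫⁻ z, f z ∂P (h ⟨n, Finset.mem_Iic.2 le_rfl⟩) := by
    intro h
    rw [lintegral_const_mul _ hf]
    rfl
  have hmeas : Measurable fun h : (_ : Finset.Iic n) → ℕ =>
      g h * ∫⁻ z, f z ∂P (h ⟨n, Finset.mem_Iic.2 le_rfl⟩) := by
    refine hg.mul ?_
    exact (measurable_from_nat (f := fun y => ∫⁻ z, f z ∂P y)).comp (measurable_pi_apply _)
  rw [← h1, pathMeasure, ← key, Measure.lintegral_compProd hF]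
  simp only [hin]
  rw [← Kernel.traj_map_frestrictLe_apply, lintegral_map hmeas hres]
  rfl

lemma lintegral_pathMeasure_zero (x : ℕ) (f : ℕ → ℝ≥0∞) :
    ∫⁻ ω, f (ω 0) ∂pathMeasure P x = f x := by
  have hf : Measurable f := measurable_from_nat
  have hres : Measurable fun ω : ℕ → ℕ =>
      (Preorder.frestrictLe 0 ω : (_ : Finset.Iic 0) → ℕ) := by fun_prop
  have hm : Measurable fun h : (_ : Finset.Iic 0) → ℕ => f (h ⟨0, Finset.mem_Iic.2 le_rfl⟩) :=
    hf.comp (measurable_pi_apply _)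
  have h1 := lintegral_map (μ := pathMeasure P x) hm hres
  have h2 : ∫⁻ ω, f (ω 0) ∂pathMeasure P x =
    ∫⁻ ω, f ((Preorder.frestrictLe 0 ω : (_ : Finset.Iic 0) → ℕ) ⟨0, Finset.mem_Iic.2 le_rfl⟩)
      ∂pathMeasure P x := rfl
  rw [h2, ← h1, pathMeasure, Kernel.traj_map_frestrictLe_apply, Kernel.partialTraj_self,
    Kernel.id_apply, lintegral_dirac' _ hm]

/-- The event that the chain avoids `a` at the times `1, …, n`. -/
def avoidSet (a n : ℕ) : Set (ℕ → ℕ) := {ω | ∀ k, 1 ≤ k → k ≤ n → ω k ≠ a}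

lemma avoidSet_zero (a : ℕ) : avoidSet a 0 = Set.univ := by
  ext ω
  simp only [avoidSet, Set.mem_ofPred_eq, Set.mem_univ, iff_true]
  intro k h1 h2
  omega

lemma mem_avoidSet_succ {a n : ℕ} {ω : ℕ → ℕ} :
    ω ∈ avoidSet a (n + 1) ↔ ω ∈ avoidSet a n ∧ ω (n + 1) ≠ a := by
  constructor
  · intro h
    exact ⟨fun k h1 h2 => h k h1 (by omega), h _ (by omega) le_rfl⟩
  · rintro ⟨h, h'⟩ k h1 h2
    rcases Nat.lt_or_ge n k with hk | hk
    · obtain rfl : k = n + 1 := by omega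
      exact h'
    · exact h k h1 hk

lemma measurableSet_avoidSet (a n : ℕ) : MeasurableSet (avoidSet a n) := by
  have : avoidSet a n = ⋂ k, ⋂ _ : 1 ≤ k, ⋂ _ : k ≤ n, (fun ω : ℕ → ℕ => ω k) ⁻¹' {a}ᶜ := by
    ext ω
    simp [avoidSet]
  rw [this]
  refine MeasurableSet.iInter fun k => MeasurableSet.iInter fun _ =>
    MeasurableSet.iInter fun _ => ?_
  exact measurable_pi_apply k (MeasurableSet.of_discrete)

/-- The expectation of `f (X n)` on the event that `a` is avoided at the times `1, …, n`. -/
noncomputable def tabooExp (x a n : ℕ) (f : ℕ → ℝ≥0∞) : ℝ≥0∞ :=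
  ∫⁻ ω in avoidSet a n, f (ω n) ∂pathMeasure P x

lemma tabooExp_zero (x a : ℕ) (f : ℕ → ℝ≥0∞) : tabooExp P x a 0 f = f x := by
  rw [tabooExp, avoidSet_zero, Measure.restrict_univ, lintegral_pathMeasure_zero]

/-- Avoidance at time `n + 1` moves into the integrand, and the rest of the event depends only on
the path up to time `n`, so the Markov property applies. -/
lemma tabooExp_succ (x a n : ℕ) (f : ℕ → ℝ≥0∞) :
    tabooExp P x a (n + 1) f =
      tabooExp P x a n fun y => ∫⁻ z, (if z = a then 0 else f z) ∂P y := by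
  classical
  rw [tabooExp, tabooExp, ← lintegral_indicator (measurableSet_avoidSet _ _),
    ← lintegral_indicator (measurableSet_avoidSet _ _)]
  let g : ((_ : Finset.Iic n) → ℕ) → ℝ≥0∞ := fun h =>
    if ∀ k : Finset.Iic n, 1 ≤ (k : ℕ) → h k ≠ a then 1 else 0
  have hg : Measurable g := by
    refine Measurable.ite ?_ measurable_const measurable_const
    have : {h : (_ : Finset.Iic n) → ℕ | ∀ k : Finset.Iic n, 1 ≤ (k : ℕ) → h k ≠ a} =
        ⋂ k : Finset.Iic n, ⋂ _ : 1 ≤ (k : ℕ), (fun h => h k) ⁻¹' {a}ᶜ := by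
      ext h
      simp
    rw [this]
    exact MeasurableSet.iInter fun k => MeasurableSet.iInter fun _ =>
      measurable_pi_apply k MeasurableSet.of_discrete
  have hgr : ∀ ω : ℕ → ℕ, g (Preorder.frestrictLe n ω) = if ω ∈ avoidSet a n then 1 else 0 := by
    intro ω
    simp only [g]
    congr 1
    simp only [avoidSet, Set.mem_ofPred_eq, eq_iff_iff]
    constructor
    · intro h k h1 h2
      exact h ⟨k, Finset.mem_Iic.2 h2⟩ h1
    · intro h k h1
      exact h k h1 (Finset.mem_Iic.1 k.2)
  have key := lintegral_pathMeasure_succ P x n hg (fun z => if z = a then 0 else f z)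
  simp only [hgr] at key
  convert key using 2
  · ext ω
    simp only [Set.indicator_apply, mem_avoidSet_succ]
    by_cases h1 : ω ∈ avoidSet a n <;> by_cases h2 : ω (n + 1) = a <;> simp [h1, h2]
  · ext ω
    simp only [Set.indicator_apply]
    by_cases h1 : ω ∈ avoidSet a n <;> simp [h1]

lemma tabooExp_one (x a n : ℕ) :
    tabooExp P x a n (fun _ => 1) = pathMeasure P x (avoidSet a n) := by
  simp [tabooExp]

lemma tabooExp_mono (x a n : ℕ) {f g : ℕ → ℝ≥0∞} (h : ∀ y, f y ≤ g y) :
    tabooExp P x a n f ≤ tabooExp P x a n g :=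
  lintegral_mono fun _ => h _

lemma tabooExp_add (x a n : ℕ) (f g : ℕ → ℝ≥0∞) :
    tabooExp P x a n (fun y => f y + g y) = tabooExp P x a n f + tabooExp P x a n g := by
  refine lintegral_add_left ?_ _
  exact (measurable_from_nat (f := f)).comp (measurable_pi_apply n)

lemma tabooExp_const_mul (x a n : ℕ) (c : ℝ≥0∞) (f : ℕ → ℝ≥0∞) :
    tabooExp P x a n (fun y => c * f y) = c * tabooExp P x a n f := by
  refine lintegral_const_mul _ ?_
  exact (measurable_from_nat (f := f)).comp (measurable_pi_apply n)

/-- Dynkin's formula for the chain killed at its first return to `a`. -/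
lemma sum_tabooExp_add {a : ℕ} {e V : ℕ → ℝ≥0∞}
    (hV : ∀ y, V y = e y + ∫⁻ z, (if z = a then 0 else V z) ∂P y) (x n : ℕ) :
    V x = ∑ k ∈ Finset.range n, tabooExp P x a k e + tabooExp P x a n V := by
  induction n with
  | zero => simp [tabooExp_zero]
  | succ n ih =>
    rw [Finset.sum_range_succ, tabooExp_succ, add_assoc, ← tabooExp_add]
    simpa only [← hV] using ih

lemma natCast_lt_returnTime {a n : ℕ} {ω : ℕ → ℕ} :
    (n : ℕ∞) < returnTime a ω ↔ ω ∈ avoidSet a n := by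
  constructor
  · intro h k h1 h2 h3
    have : returnTime a ω ≤ k := iInf₂_le_of_le k ⟨h1, h3⟩ le_rfl
    exact absurd (h.trans_le this) (by exact_mod_cast not_lt.2 h2)
  · intro h
    have h2 : ((n + 1 : ℕ) : ℕ∞) ≤ returnTime a ω := by
      refine le_iInf₂ fun k hk => ?_
      by_contra hlt
      have : k < n + 1 := by exact_mod_cast not_le.1 hlt
      exact h k hk.1 (by omega) hk.2
    exact lt_of_lt_of_le (by exact_mod_cast Nat.lt_succ_self n) h2

lemma toENNReal_eq_tsum (t : ℕ∞) :
    (t : ℝ≥0∞) = ∑' n : ℕ, if (n : ℕ∞) < t then 1 else 0 := by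
  induction t using ENat.recTopCoe with
  | top => simp
  | coe k =>
    rw [tsum_eq_sum (s := Finset.range k)]
    · rw [Finset.sum_congr rfl (g := fun _ => 1)]
      · simp
      · intro n hn
        simp [Finset.mem_range.1 hn]
    · intro n hn
      simp at hn
      simp [hn]

lemma lintegral_returnTime (x a : ℕ) :
    ∫⁻ ω, (returnTime a ω : ℝ≥0∞) ∂pathMeasure P x =
      ∑' n : ℕ, pathMeasure P x (avoidSet a n) := by
  classical
  have h : ∀ ω, (returnTime a ω : ℝ≥0∞) = ∑' n : ℕ, (avoidSet a n).indicator 1 ω := by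
    intro ω
    rw [toENNReal_eq_tsum]
    refine tsum_congr fun n => ?_
    simp only [natCast_lt_returnTime, Set.indicator_apply, Pi.one_apply]
  simp only [h]
  rw [lintegral_tsum fun n =>
    (measurable_one.indicator (measurableSet_avoidSet a n)).aemeasurable]
  refine tsum_congr fun n => ?_
  rw [lintegral_indicator_one (measurableSet_avoidSet a n)]

variable {P}

lemma isRecurrentState_iff {a : ℕ} :
    IsRecurrentState P a ↔ pathMeasure P a (⋂ n, avoidSet a n) = 0 := by
  have hset : {ω | returnTime a ω < ⊤} = (⋂ n, avoidSet a n)ᶜ := by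
    ext ω
    simp only [Set.mem_ofPred_eq, Set.mem_compl_iff, Set.mem_iInter, ← natCast_lt_returnTime,
      lt_top_iff_ne_top, Ne, not_iff_not]
    rw [ENat.eq_top_iff_forall_gt]
  rw [IsRecurrentState, hset, prob_compl_eq_one_iff
    (MeasurableSet.iInter fun n => measurableSet_avoidSet a n)]

lemma isRecurrentState_of_forall_exists {a : ℕ}
    (h : ∀ ε : ℝ≥0∞, ε ≠ 0 → ∃ n, pathMeasure P a (avoidSet a n) ≤ ε) : IsRecurrentState P a := by
  have h0 : pathMeasure P a (⋂ n, avoidSet a n) = 0 := by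
    by_contra hne
    have hpos : pathMeasure P a (⋂ n, avoidSet a n) / 2 ≠ 0 := by simp [hne]
    obtain ⟨n, hn⟩ := h _ hpos
    have := (measure_mono (Set.iInter_subset (avoidSet a) n)).trans hn
    exact absurd this (not_le.2 (ENNReal.half_lt_self hne (measure_ne_top _ _)))
  exact isRecurrentState_iff.2 h0

/-- Foster's criterion. -/
lemma isPositiveRecurrentState_of_lyapunov {a : ℕ} {V : ℕ → ℝ≥0∞} (ha : V a ≠ ∞)
    (hV : ∀ y, V y = 1 + ∫⁻ z, (if z = a then 0 else V z) ∂P y) :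
    IsPositiveRecurrentState P a := by
  rw [IsPositiveRecurrentState, lintegral_returnTime]
  refine lt_of_le_of_lt (ENNReal.tsum_le_of_sum_range_le (c := V a) fun n => ?_) ha.lt_top
  rw [sum_tabooExp_add P (e := fun _ => 1) hV a n]
  simp only [tabooExp_one]
  exact le_self_add

/-- Dynkin's formula makes the killed expectations of `e` summable, so they tend to `0`: as `e > 0`,
the surviving mass leaves every finite set. Far out `V` is large, while the killed expectation of
`V` stays below `V a`, so little mass can survive there either. -/
lemma isRecurrentState_of_lyapunov {a : ℕ} {e V : ℕ → ℝ≥0∞} (ha : V a ≠ ∞)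
    (hV : ∀ y, V y = e y + ∫⁻ z, (if z = a then 0 else V z) ∂P y)
    (he : ∀ y, e y ≠ 0) (hlim : Tendsto V atTop (𝓝 ∞)) : IsRecurrentState P a := by
  have hsum : ∑' n, tabooExp P a a n e ≤ V a :=
    ENNReal.tsum_le_of_sum_range_le fun n => by
      rw [sum_tabooExp_add P hV a n]
      exact le_self_add
  have htend : Tendsto (fun n => tabooExp P a a n e) atTop (𝓝 0) :=
    ENNReal.tendsto_atTop_zero_of_tsum_ne_top (hsum.trans_lt ha.lt_top).ne
  have hVle : ∀ n, tabooExp P a a n V ≤ V a := fun n => by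
    conv_rhs => rw [sum_tabooExp_add P hV a n]
    exact le_add_self
  refine isRecurrentState_of_forall_exists fun ε hε => ?_
  by_cases hεt : ε = ∞
  · exact ⟨0, by simp [hεt]⟩
  -- `1 ≤ L * e + δ * V` for a small `δ` and a large `L`
  obtain ⟨δ, hδ0, hδ⟩ : ∃ δ : ℝ≥0∞, δ ≠ 0 ∧ δ * V a ≤ ε / 2 := by
    obtain ⟨δ, h1, h2⟩ := ENNReal.exists_pos_mul_lt ha (b := ε / 2) (by simp [hε])
    exact ⟨δ, h1.ne', h2.le⟩
  have hδt : ∃ N, ∀ y, N ≤ y → 1 ≤ δ * V y := by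
    have := ENNReal.Tendsto.const_mul (a := δ) hlim (Or.inl ENNReal.top_ne_zero)
    rw [ENNReal.mul_top hδ0] at this
    exact eventually_atTop.1
      ((this.eventually (lt_mem_nhds ENNReal.one_lt_top)).mono fun _ h => h.le)
  obtain ⟨N, hN⟩ := hδt
  let L : ℝ≥0∞ := ∑ y ∈ Finset.range N, (e y)⁻¹
  have hL : L ≠ ∞ := by
    simp only [L, ENNReal.sum_ne_top]
    intro y _
    exact ENNReal.inv_ne_top.2 (he y)
  have heV : ∀ y, e y ≤ V y := fun y => by rw [hV y]; exact le_self_add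
  have hbound : ∀ y, 1 ≤ L * e y + δ * V y := by
    intro y
    rcases lt_or_ge y N with hy | hy
    · by_cases hyt : e y = ∞
      · have hVt : V y = ∞ := top_le_iff.1 (hyt ▸ heV y)
        simp [hVt, ENNReal.mul_top hδ0]
      refine le_add_right ?_
      rw [← ENNReal.inv_mul_cancel (he y) hyt]
      gcongr
      exact Finset.single_le_sum (f := fun y => (e y)⁻¹) (fun _ _ => zero_le)
        (Finset.mem_range.2 hy)
    · exact le_add_left (hN y hy)
  have hLt : Tendsto (fun n => L * tabooExp P a a n e) atTop (𝓝 0) := by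
    simpa using ENNReal.Tendsto.const_mul htend (Or.inr hL)
  have hε2 : (0 : ℝ≥0∞) < ε / 2 := ENNReal.half_pos hε
  obtain ⟨n, hn⟩ := (hLt.eventually (gt_mem_nhds hε2)).exists
  refine ⟨n, ?_⟩
  calc pathMeasure P a (avoidSet a n) = tabooExp P a a n fun _ => 1 := (tabooExp_one P a a n).symm
    _ ≤ tabooExp P a a n fun y => L * e y + δ * V y := tabooExp_mono P a a n hbound
    _ = L * tabooExp P a a n e + δ * tabooExp P a a n V := by
      rw [tabooExp_add, tabooExp_const_mul, tabooExp_const_mul]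
    _ ≤ ε / 2 + ε / 2 := by
      gcongr
      exact (mul_le_mul_right (hVle n) δ).trans hδ
    _ = ε := ENNReal.add_halves ε

lemma tendsto_measure_avoidSet {a : ℕ} (h : IsRecurrentState P a) :
    Tendsto (fun n => pathMeasure P a (avoidSet a n)) atTop (𝓝 0) := by
  have hanti : Antitone (avoidSet a) := fun m n hmn ω hω k h1 h2 => hω k h1 (h2.trans hmn)
  have := tendsto_measure_iInter_atTop (μ := pathMeasure P a) (s := avoidSet a)
    (fun n => (measurableSet_avoidSet a n).nullMeasurableSet) hanti ⟨0, measure_ne_top _ _⟩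
  rwa [isRecurrentState_iff.1 h] at this

/-- A bounded solution of the killed Poisson equation with right hand side at most `1` bounds the
mean return time of a recurrent state from below. -/
lemma le_lintegral_returnTime {a : ℕ} (hrec : IsRecurrentState P a) {e V : ℕ → ℝ≥0∞}
    (hV : ∀ y, V y = e y + ∫⁻ z, (if z = a then 0 else V z) ∂P y)
    (he : ∀ y, e y ≤ 1) {C : ℝ≥0∞} (hC : C ≠ ∞) (hVC : ∀ y, V y ≤ C) :
    V a ≤ ∫⁻ ω, (returnTime a ω : ℝ≥0∞) ∂pathMeasure P a := by
  rw [lintegral_returnTime]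
  -- The remainder in Dynkin's formula is at most `C` times the survival probability, which vanishes
  -- in the limit by recurrence.
  have h1 : ∀ n, V a ≤ ∑' n : ℕ, pathMeasure P a (avoidSet a n) +
      C * pathMeasure P a (avoidSet a n) := by
    intro n
    rw [sum_tabooExp_add P hV a n]
    gcongr
    · refine (Finset.sum_le_sum fun k _ => ?_).trans (ENNReal.sum_le_tsum (Finset.range n))
      rw [← tabooExp_one]
      exact tabooExp_mono P a a k he
    · rw [← tabooExp_one, ← tabooExp_const_mul]
      exact tabooExp_mono P a a n fun y => by simpa using hVC y
  have h2 := (ENNReal.Tendsto.const_mul (tendsto_measure_avoidSet hrec) (Or.inr hC)).const_add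
    (∑' n : ℕ, pathMeasure P a (avoidSet a n))
  rw [mul_zero, add_zero] at h2
  exact ge_of_tendsto' h2 h1

end PathMeasure

/-! ### Detailed balance, the Poisson equation and recurrence -/

section BirthDeath

variable {P : Kernel ℕ ℕ}

lemma IsBirthDeath.birthProb_pos (hP : IsBirthDeath P) (x : ℕ) : 0 < birthProb P x := by
  refine lt_of_le_of_ne measureReal_nonneg (Ne.symm fun h => ?_)
  refine (hP.eq_zero_iff x (x + 1)).1 h ?_
  push_cast
  rw [show (x : ℤ) - (x + 1) = -1 by ring]
  simp

lemma deathProb_nonneg (P : Kernel ℕ ℕ) (x : ℕ) : 0 ≤ deathProb P x := measureReal_nonneg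

/-- Truncated subtraction turns `deathProb P 0` into `p(0, 0)`. Its vanishing lets later formulas
include `x = 0` without a separate case. -/
lemma IsBirthDeath.deathProb_zero (hP : IsBirthDeath P) : deathProb P 0 = 0 := by
  refine (hP.eq_zero_iff 0 (0 - 1)).2 ?_
  simp

lemma IsBirthDeath.deathProb_succ_pos (hP : IsBirthDeath P) (x : ℕ) :
    0 < deathProb P (x + 1) := by
  refine lt_of_le_of_ne measureReal_nonneg (Ne.symm fun h => ?_)
  refine (hP.eq_zero_iff (x + 1) (x + 1 - 1)).1 h ?_
  simp

/-- The positive function `w` on `ℕ` satisfies the detailed balance equations of the chain. -/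
structure IsBalanced (P : Kernel ℕ ℕ) (w : ℕ → ℝ) : Prop where
  pos : ∀ x, 0 < w x
  balance : ∀ x, birthProb P x * w x = deathProb P (x + 1) * w (x + 1)

/-- The solution with value `1` at `0` of the detailed balance equations. -/
noncomputable def balanceWeight (P : Kernel ℕ ℕ) : ℕ → ℝ
  | 0 => 1
  | x + 1 => birthProb P x * balanceWeight P x / deathProb P (x + 1)

lemma IsBirthDeath.isBalanced_balanceWeight (hP : IsBirthDeath P) :
    IsBalanced P (balanceWeight P) where
  pos x := by
    induction x with
    | zero => exact one_pos
    | succ x ih =>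
      exact div_pos (mul_pos (hP.birthProb_pos x) ih) (hP.deathProb_succ_pos x)
  balance x := by
    have := (hP.deathProb_succ_pos x).ne'
    rw [balanceWeight]
    field_simp

/-- Two solutions of the detailed balance equations are proportional. -/
lemma IsBalanced.eq_mul_balanceWeight (hP : IsBirthDeath P) {w : ℕ → ℝ} (hw : IsBalanced P w)
    (x : ℕ) : w x = w 0 * balanceWeight P x := by
  induction x with
  | zero => simp [balanceWeight]
  | succ x ih =>
    have hq := (hP.deathProb_succ_pos x).ne'
    have h := hw.balance x
    rw [balanceWeight, ← mul_div_assoc, eq_div_iff hq, mul_comm (w (x + 1)), ← h, ih]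
    ring

variable [IsMarkovKernel P]

lemma IsBirthDeath.apply_eq (hP : IsBirthDeath P) (x : ℕ) :
    P x = ENNReal.ofReal (birthProb P x) • Measure.dirac (x + 1) +
      ENNReal.ofReal (deathProb P x) • Measure.dirac (x - 1) := by
  refine Measure.ext_of_singleton fun y => ?_
  have h1 : ENNReal.ofReal (birthProb P x) = P x {x + 1} := by
    simp [birthProb, transProb]
  have h2 : ENNReal.ofReal (deathProb P x) = P x {x - 1} := by
    simp [deathProb, transProb]
  simp only [Measure.coe_add, Measure.coe_smul, Pi.add_apply, Pi.smul_apply, smul_eq_mul,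
    Measure.dirac_apply' _ (measurableSet_singleton y), Set.indicator_apply,
    Set.mem_singleton_iff, Pi.one_apply, h1, h2]
  by_cases hy1 : x + 1 = y
  · subst hy1
    have : x - 1 ≠ x + 1 := by omega
    simp [this]
  · by_cases hy2 : x - 1 = y
    · subst hy2
      have : x + 1 ≠ x - 1 := by omega
      simp [this]
    · have h0 : transProb P x y = 0 := by
        refine (hP.eq_zero_iff x y).2 fun h => ?_
        rcases (abs_eq zero_le_one).1 h with h | h <;> omega
      simp [hy1, hy2]
      simpa [transProb, measureReal_def, ENNReal.toReal_eq_zero_iff] using h0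

lemma IsBirthDeath.lintegral (hP : IsBirthDeath P) (x : ℕ) (f : ℕ → ℝ≥0∞) :
    ∫⁻ y, f y ∂P x = ENNReal.ofReal (birthProb P x) * f (x + 1) +
      ENNReal.ofReal (deathProb P x) * f (x - 1) := by
  rw [hP.apply_eq x]
  simp [lintegral_add_measure, lintegral_smul_measure]

lemma IsBirthDeath.transOp_eq (hP : IsBirthDeath P) (x : ℕ) (f : ℕ → ℝ) :
    transOp P f x = birthProb P x * f (x + 1) + deathProb P x * f (x - 1) := by
  have hi : ∀ c z, Integrable f (ENNReal.ofReal c • Measure.dirac z) := fun c z =>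
    (integrable_dirac (by simp)).smul_measure ENNReal.ofReal_ne_top
  rw [transOp, hP.apply_eq x, integral_add_measure (hi _ _) (hi _ _)]
  simp [integral_smul_measure, (hP.birthProb_pos x).le, deathProb_nonneg]

lemma IsBirthDeath.birthProb_add_deathProb (hP : IsBirthDeath P) (x : ℕ) :
    birthProb P x + deathProb P x = 1 := by
  have h := hP.transOp_eq x (fun _ => 1)
  simpa [transOp] using h.symm

/-- The solution of the Poisson equation `W = ε + P W` off `a` that vanishes at `a`. -/
lemma IsBirthDeath.exists_poisson (hP : IsBirthDeath P) {w : ℕ → ℝ} (hw : IsBalanced P w)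
    {ε : ℕ → ℝ} (hε : ∀ x, 0 ≤ ε x) (hs : Summable fun x => ε x * w x) {C : ℝ} (hC : 0 ≤ C)
    (a : ℕ) :
    ∃ W : ℕ → ℝ, (∀ y, 0 ≤ W y) ∧ W a = 0 ∧
      (∀ y, y ≠ a → W y = ε y + birthProb P y * W (y + 1) + deathProb P y * W (y - 1)) ∧
      ∀ y, a ≤ y → W (y + 1) = W y +
        (C + ∑' k, ε (k + (y + 1)) * w (k + (y + 1))) / (birthProb P y * w y) := by
  have hp := hP.birthProb_pos
  have hpw : ∀ y, 0 < birthProb P y * w y := fun y => mul_pos (hp y) (hw.pos y)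
  have hεw : ∀ y, 0 ≤ ε y * w y := fun y => mul_nonneg (hε y) (hw.pos y).le
  -- The flux through the edge from `y` to `y + 1` must drop by `ε y * w y` as `y` is crossed. Above
  -- `a` it is `t (y + 1)`, with `C` the flux left at infinity; below `a` it is `-s y`, since
  -- nothing flows below `0`.
  let t : ℕ → ℝ := fun y => C + ∑' k, ε (k + y) * w (k + y)
  let s : ℕ → ℝ := fun y => ∑ k ∈ Finset.range (y + 1), ε k * w k
  have ht0 : ∀ y, 0 ≤ t y := fun y => add_nonneg hC (tsum_nonneg fun k => hεw _)
  have hs0 : ∀ y, 0 ≤ s y := fun y => Finset.sum_nonneg fun k _ => hεw _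
  have ht : ∀ y, t y = ε y * w y + t (y + 1) := by
    intro y
    have h1 : Summable fun k => ε (k + y) * w (k + y) :=
      (summable_nat_add_iff (f := fun x => ε x * w x) y).2 hs
    have h2 := h1.tsum_eq_zero_add
    simp only [t]
    rw [h2]
    simp only [zero_add, add_assoc, add_comm 1 y]
    ring
  have hss : ∀ y, s (y + 1) = s y + ε (y + 1) * w (y + 1) := fun y =>
    Finset.sum_range_succ _ _
  -- At most one of the two sums is nonempty: the increments, flux over conductance, are summed away
  -- from `a`.
  let W : ℕ → ℝ := fun y => ∑ j ∈ Finset.Ico a y, t (j + 1) / (birthProb P j * w j) +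
    ∑ j ∈ Finset.Ico y a, s j / (birthProb P j * w j)
  have hup : ∀ y, a ≤ y → W (y + 1) = W y + t (y + 1) / (birthProb P y * w y) := by
    intro y hy
    simp only [W]
    rw [Finset.sum_Ico_succ_top hy, Finset.Ico_eq_empty_of_le hy,
      Finset.Ico_eq_empty_of_le (by omega : a ≤ y + 1)]
    simp
  have hdown : ∀ y, y < a → W y = W (y + 1) + s y / (birthProb P y * w y) := by
    intro y hy
    simp only [W]
    rw [Finset.sum_eq_sum_Ico_succ_bot hy, Finset.Ico_eq_empty_of_le hy.le,
      Finset.Ico_eq_empty_of_le (by omega : y + 1 ≤ a)]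
    simp [add_comm]
  refine ⟨W, fun y => ?_, by simp [W], fun y hy => ?_, hup⟩
  · exact add_nonneg (Finset.sum_nonneg fun j _ => div_nonneg (ht0 _) (hpw j).le)
      (Finset.sum_nonneg fun j _ => div_nonneg (hs0 _) (hpw j).le)
  · have hsum := hP.birthProb_add_deathProb y
    have hwy := (hw.pos y).ne'
    have hpy := (hp y).ne'
    rcases lt_or_gt_of_ne hy with hlt | hgt
    · have e1 := hdown y hlt
      cases y with
      | zero =>
        have hs1 : s 0 = ε 0 * w 0 := by simp [s]
        rw [hP.deathProb_zero] at hsum ⊢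
        rw [e1, hs1]
        have : birthProb P 0 = 1 := by linarith
        rw [this]
        field_simp
        ring
      | succ z =>
        have e2 := hdown z (by omega)
        rw [hw.balance z] at e2
        rw [Nat.add_sub_cancel, e2]
        have hq := (hP.deathProb_succ_pos z).ne'
        have h3 : deathProb P (z + 1) * (s z / (deathProb P (z + 1) * w (z + 1))) =
            s z / w (z + 1) := by field_simp
        have h4 : birthProb P (z + 1) * (s (z + 1) / (birthProb P (z + 1) * w (z + 1))) =
            s z / w (z + 1) + ε (z + 1) := by rw [hss]; field_simp
        linear_combination (birthProb P (z + 1)) * e1 - W (z + 1) * hsum - h3 + h4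
    · cases y with
      | zero => omega
      | succ z =>
        have e1 := hup (z + 1) (by omega)
        have e2 := hup z (by omega)
        rw [hw.balance z] at e2
        rw [Nat.add_sub_cancel]
        have hq := (hP.deathProb_succ_pos z).ne'
        have h3 : deathProb P (z + 1) * (t (z + 1) / (deathProb P (z + 1) * w (z + 1))) =
            ε (z + 1) + t (z + 1 + 1) / w (z + 1) := by rw [ht (z + 1)]; field_simp
        have h4 : birthProb P (z + 1) * (t (z + 1 + 1) / (birthProb P (z + 1) * w (z + 1))) =
            t (z + 1 + 1) / w (z + 1) := by field_simp
        linear_combination - (birthProb P (z + 1)) * e1 - W (z + 1) * hsum - h4 + h3 +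
          deathProb P (z + 1) * e2

/-- The killed Poisson equation for the function `W` of `IsBirthDeath.exists_poisson`. -/
lemma IsBirthDeath.ofReal_poisson (hP : IsBirthDeath P) {ε W : ℕ → ℝ} {a : ℕ}
    (hε : ∀ x, 0 ≤ ε x) (hW : ∀ y, 0 ≤ W y) (ha : W a = 0)
    (h : ∀ y, y ≠ a → W y = ε y + birthProb P y * W (y + 1) + deathProb P y * W (y - 1))
    {V : ℕ → ℝ≥0∞} (hV : V = fun y => ENNReal.ofReal
      (ε y + birthProb P y * W (y + 1) + deathProb P y * W (y - 1))) (y : ℕ) :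
    V y = ENNReal.ofReal (ε y) + ∫⁻ z, (if z = a then 0 else V z) ∂P y := by
  -- `V` and `W` agree off `a`. At `a` the function `W` vanishes, which encodes the killing, while
  -- `V a` is the value for an excursion started at `a`.
  have hz : ∀ z, (if z = a then 0 else V z) = ENNReal.ofReal (W z) := by
    intro z
    by_cases hza : z = a
    · simp [hza, ha]
    · simp only [if_neg hza, hV]
      rw [← h z hza]
  simp only [hz]
  have h1 : 0 ≤ birthProb P y * W (y + 1) := mul_nonneg (hP.birthProb_pos y).le (hW _)
  have h2 : 0 ≤ deathProb P y * W (y - 1) := mul_nonneg (deathProb_nonneg P y) (hW _)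
  simp only [hV]
  rw [hP.lintegral, ← ENNReal.ofReal_mul (hP.birthProb_pos y).le,
    ← ENNReal.ofReal_mul (deathProb_nonneg P y), ← ENNReal.ofReal_add h1 h2,
    ← ENNReal.ofReal_add (hε y) (add_nonneg h1 h2), add_assoc]

/-- For `ε = 1` the series required by `exists_poisson` is `∑ w`, and Foster's criterion applies to
the resulting solution. -/
theorem IsBirthDeath.isPositiveRecurrent (hP : IsBirthDeath P) {w : ℕ → ℝ}
    (hw : IsBalanced P w) (hs : Summable w) : IsPositiveRecurrent P := by
  intro a
  obtain ⟨W, h0, ha, hW, -⟩ := hP.exists_poisson hw (ε := fun _ => 1) (fun _ => zero_le_one)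
    (by simpa using hs) le_rfl a
  have key := hP.ofReal_poisson (fun _ => zero_le_one) h0 ha hW rfl
  simp only [ENNReal.ofReal_one] at key
  exact isPositiveRecurrentState_of_lyapunov ENNReal.ofReal_ne_top key

/-- A unit flux at infinity (`C = 1`) makes `W` grow at least like the partial sums of `1 / a`,
hence tend to infinity. -/
theorem IsBirthDeath.isRecurrent (hP : IsBirthDeath P) {w : ℕ → ℝ} (hw : IsBalanced P w)
    (hs : ¬ Summable fun x => 1 / (birthProb P x * w x)) : IsRecurrent P := by
  intro a
  -- The source must be positive everywhere with `ε * w` summable, even though `w` itself need not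
  -- be summable.
  have hε : ∀ x, 0 < (1 / 2 : ℝ) ^ x / w x := fun x => div_pos (by positivity) (hw.pos x)
  have hpw : ∀ y, 0 < birthProb P y * w y := fun y => mul_pos (hP.birthProb_pos y) (hw.pos y)
  have hsum : Summable fun x => (1 / 2 : ℝ) ^ x / w x * w x := by
    refine summable_geometric_two.congr fun x => ?_
    rw [div_mul_cancel₀ _ (hw.pos x).ne']
  obtain ⟨W, h0, ha, hW, hup⟩ := hP.exists_poisson hw (fun x => (hε x).le) hsum zero_le_one a
  have key := hP.ofReal_poisson (fun x => (hε x).le) h0 ha hW rfl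
  refine isRecurrentState_of_lyapunov ENNReal.ofReal_ne_top key
    (fun y => (ENNReal.ofReal_pos.2 (hε y)).ne') ?_
  have hnn : ∀ x, 0 ≤ 1 / (birthProb P x * w x) := fun x => (one_div_pos.2 (hpw x)).le
  have hdiv := (not_summable_iff_tendsto_nat_atTop_of_nonneg hnn).1 hs
  have hge : ∀ y, a ≤ y → ∑ j ∈ Finset.range y, 1 / (birthProb P j * w j) -
      ∑ j ∈ Finset.range a, 1 / (birthProb P j * w j) ≤ W y := by
    intro y hy
    induction y, hy using Nat.le_induction with
    | base => simp [ha]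
    | succ y hy ih =>
      rw [Finset.sum_range_succ, hup y hy]
      have : 1 / (birthProb P y * w y) ≤ (1 + ∑' k, (1 / 2 : ℝ) ^ (k + (y + 1)) /
          w (k + (y + 1)) * w (k + (y + 1))) / (birthProb P y * w y) := by
        refine div_le_div_of_nonneg_right ?_ (hpw y).le
        exact le_add_of_nonneg_right (tsum_nonneg fun k => mul_nonneg (hε _).le (hw.pos _).le)
      linarith
  have hWt : Tendsto W atTop atTop := by
    refine tendsto_atTop_mono' atTop ?_ (tendsto_atTop_add_const_right atTop
      (-∑ j ∈ Finset.range a, 1 / (birthProb P j * w j)) hdiv)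
    filter_upwards [eventually_ge_atTop a] with y hy
    simpa [sub_eq_add_neg] using hge y hy
  refine (ENNReal.tendsto_ofReal_atTop.comp hWt).congr' ?_
  filter_upwards [eventually_gt_atTop a] with y hy
  simp only [Function.comp_apply]
  rw [hW y hy.ne']

/-- Truncating the source `1` after `a + n` makes the flux vanish beyond, so the solution is bounded
and `V a` is at most the mean return time. But `w a * V a` is at least the sum of `w` over `a + 1,
…, a + n`, so a finite mean would bound the partial sums of `w`. -/
theorem IsBirthDeath.not_isPositiveRecurrentState (hP : IsBirthDeath P) {w : ℕ → ℝ}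
    (hw : IsBalanced P w) (hs : ¬ Summable w) {a : ℕ} (hrec : IsRecurrentState P a) :
    ¬ IsPositiveRecurrentState P a := by
  intro hpr
  refine hs ((summable_nat_add_iff (a + 1)).1 ?_)
  refine summable_of_sum_range_le (c := w a *
    (∫⁻ ω, (returnTime a ω : ℝ≥0∞) ∂pathMeasure P a).toReal) (fun k => (hw.pos _).le) fun n => ?_
  let ε : ℕ → ℝ := fun x => if x < a + 1 + n then 1 else 0
  have hε : ∀ x, 0 ≤ ε x := fun x => by simp only [ε]; split_ifs <;> norm_num
  have hsum : Summable fun x => ε x * w x :=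
    summable_of_ne_finset_zero (s := Finset.range (a + 1 + n)) fun x hx => by
      simp only [ε, Finset.mem_range] at hx ⊢
      simp [hx]
  obtain ⟨W, h0, ha, hW, hup⟩ := hP.exists_poisson hw hε hsum le_rfl a
  set V : ℕ → ℝ≥0∞ := fun y => ENNReal.ofReal
      (ε y + birthProb P y * W (y + 1) + deathProb P y * W (y - 1)) with hV
  have key := hP.ofReal_poisson hε h0 ha hW hV
  have hconst : ∀ y, a + 1 + n ≤ y → W y = W (a + 1 + n) := by
    intro y hy
    induction y, hy using Nat.le_induction with
    | base => rfl
    | succ y hy ih =>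
      have hz : ∀ k, ε (k + (y + 1)) * w (k + (y + 1)) = 0 := fun k => by
        have : ¬ k + (y + 1) < a + 1 + n := by omega
        simp [ε, this]
      rw [hup y (by omega), ih]
      simp [hz]
  have hVC : ∀ y, V y ≤ V a + ∑ x ∈ Finset.range (a + 1 + n + 1), ENNReal.ofReal (W x) := by
    intro y
    by_cases hy : y = a
    · rw [hy]; exact le_self_add
    have hVy : V y = ENNReal.ofReal (W y) := by simp only [hV]; rw [← hW y hy]
    refine le_add_left ?_
    rw [hVy]
    rcases le_total y (a + 1 + n) with h | h
    · exact Finset.single_le_sum (f := fun x => ENNReal.ofReal (W x)) (fun _ _ => zero_le)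
        (Finset.mem_range.2 (by omega))
    · rw [hconst y h]
      exact Finset.single_le_sum (f := fun x => ENNReal.ofReal (W x)) (fun _ _ => zero_le)
        (Finset.mem_range.2 (by omega))
  have hle := le_lintegral_returnTime hrec key (fun y => ENNReal.ofReal_le_one.2 (by
    simp only [ε]; split_ifs <;> norm_num)) (by simp [hV]) hVC
  have h1 := (ENNReal.ofReal_le_iff_le_toReal hpr.ne).1 hle
  have hwa := hw.pos a
  have hpa := hP.birthProb_pos a
  have h2 := hup a le_rfl
  rw [ha, zero_add, zero_add] at h2
  have hs' : Summable fun k => ε (k + (a + 1)) * w (k + (a + 1)) :=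
    (summable_nat_add_iff (f := fun x => ε x * w x) (a + 1)).2 hsum
  have h3 : ∑ k ∈ Finset.range n, w (k + (a + 1)) ≤
      ∑' k, ε (k + (a + 1)) * w (k + (a + 1)) := by
    refine le_trans (le_of_eq (Finset.sum_congr rfl fun k hk => ?_))
      (hs'.sum_le_tsum (Finset.range n) fun k _ => mul_nonneg (hε _) (hw.pos _).le)
    have : k + (a + 1) < a + 1 + n := by have := Finset.mem_range.1 hk; omega
    simp [ε, this]
  have h4 : (∑' k, ε (k + (a + 1)) * w (k + (a + 1))) = w a * (birthProb P a * W (a + 1)) := by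
    rw [h2]; field_simp
  have h5 : birthProb P a * W (a + 1) ≤
      ε a + birthProb P a * W (a + 1) + deathProb P a * W (a - 1) := by
    have := hε a
    have := mul_nonneg (deathProb_nonneg P a) (h0 (a - 1))
    linarith
  calc _ ≤ _ := h3
    _ = _ := h4
    _ ≤ _ := mul_le_mul_of_nonneg_left (h5.trans h1) hwa.le

end BirthDeath

/-! ### Integrals over `ℕ` as series -/

section CountableIntegral

variable {μ : Measure ℕ} [IsFiniteMeasure μ] {f : ℕ → ℝ}

lemma integrable_nat_iff : Integrable f μ ↔ Summable fun x => μ.real {x} * f x := by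
  conv_lhs => rw [← Measure.sum_smul_dirac μ]
  rw [integrable_sum_dirac_iff fun x => measure_ne_top μ {x},
    ← summable_abs_iff (f := fun x => μ.real {x} * f x)]
  simp only [abs_mul, measureReal_def, ENNReal.abs_toReal, Real.norm_eq_abs]

lemma hasSum_integral_nat (hf : Integrable f μ) :
    HasSum (fun x => μ.real {x} * f x) (∫ x, f x ∂μ) := by
  have h := (integrable_nat_iff.1 hf).hasSum
  rwa [← show ∫ x, f x ∂μ = ∑' x, μ.real {x} * f x by simpa using integral_countable hf] at h

lemma hasSum_integral_of_hasSum {s : ℝ} (h : HasSum (fun x => μ.real {x} * f x) s) :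
    ∫ x, f x ∂μ = s :=
  (hasSum_integral_nat (integrable_nat_iff.2 h.summable)).unique h

lemma real_Ioi_eq_tsum (x : ℕ) : μ.real (Set.Ioi x) = ∑' k, μ.real {k + (x + 1)} := by
  have hi : Integrable ((Set.Ioi x).indicator (1 : ℕ → ℝ)) μ :=
    (integrable_const (1 : ℝ)).indicator MeasurableSet.of_discrete
  have h := hasSum_integral_nat hi
  rw [integral_indicator_one MeasurableSet.of_discrete] at h
  rw [← h.tsum_eq, ← h.summable.sum_add_tsum_nat_add (x + 1), Finset.sum_eq_zero, zero_add]
  · refine tsum_congr fun k => ?_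
    rw [Set.indicator_of_mem (Set.mem_Ioi.2 (by omega)), Pi.one_apply, mul_one]
  · intro k hk
    have := Finset.mem_range.1 hk
    rw [Set.indicator_of_notMem (by simp; omega), mul_zero]

end CountableIntegral

/-! ### Reversible laws, the Dirichlet form and the spectral gap -/

section Reversible

variable {P : Kernel ℕ ℕ} {π : Measure ℕ}

lemma IsReversibleLaw.isBalanced (hπ : IsReversibleLaw P π) :
    IsBalanced P fun x => π.real {x} where
  pos := hπ.pos
  balance x := by simpa [birthProb, deathProb] using hπ.detailedBalance x (x + 1)

lemma IsReversibleLaw.hasSum (hπ : IsReversibleLaw P π) : HasSum (fun x => π.real {x}) 1 := by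
  have := hπ.isProbabilityMeasure
  simpa using hasSum_integral_nat (integrable_const (1 : ℝ) (μ := π))

lemma IsBalanced.isReversibleLaw (hP : IsBirthDeath P) {w : ℕ → ℝ} (hw : IsBalanced P w)
    (hs : HasSum w 1) :
    IsReversibleLaw P (Measure.sum fun x => ENNReal.ofReal (w x) • Measure.dirac x) := by
  have hreal : ∀ x, (Measure.sum fun x => ENNReal.ofReal (w x) • Measure.dirac x).real {x} =
      w x := fun x => by
    rw [measureReal_def, Measure.sum_smul_dirac_singleton, ENNReal.toReal_ofReal (hw.pos x).le]
  refine ⟨⟨?_⟩, fun x => by rw [hreal]; exact hw.pos x, fun x y => ?_⟩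
  · rw [Measure.sum_apply _ MeasurableSet.univ]
    simp only [Measure.smul_apply, measure_univ, smul_eq_mul, mul_one]
    rw [← ENNReal.ofReal_tsum_of_nonneg (fun x => (hw.pos x).le) hs.summable, hs.tsum_eq,
      ENNReal.ofReal_one]
  · rw [hreal, hreal]
    by_cases h : |(x : ℤ) - (y : ℤ)| = 1
    · rcases (abs_eq zero_le_one).1 h with h | h
      · obtain rfl : x = y + 1 := by omega
        simpa [birthProb, deathProb] using (hw.balance y).symm
      · obtain rfl : y = x + 1 := by omega
        simpa [birthProb, deathProb] using hw.balance x
    · rw [(hP.eq_zero_iff x y).2 h, (hP.eq_zero_iff y x).2 (by rwa [abs_sub_comm]),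
        zero_mul, zero_mul]

theorem IsBirthDeath.existsUnique_isReversibleLaw (hP : IsBirthDeath P)
    (hs : Summable (balanceWeight P)) : ∃! π : Measure ℕ, IsReversibleLaw P π := by
  have hb := hP.isBalanced_balanceWeight
  have hZ : 0 < ∑' x, balanceWeight P x := hs.tsum_pos (fun x => (hb.pos x).le) 0 (hb.pos 0)
  have hw : IsBalanced P fun x => balanceWeight P x / ∑' x, balanceWeight P x :=
    ⟨fun x => div_pos (hb.pos x) hZ, fun x => by
      simp only [← mul_div_assoc, hb.balance x]⟩
  have h1 : HasSum (fun x => balanceWeight P x / ∑' x, balanceWeight P x) 1 := by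
    have := hs.hasSum.div_const (∑' x, balanceWeight P x)
    rwa [div_self hZ.ne'] at this
  refine ⟨_, hw.isReversibleLaw hP h1, fun ν hν => ?_⟩
  have hu : ∀ ρ : Measure ℕ, IsReversibleLaw P ρ → ∀ x,
      ρ.real {x} = balanceWeight P x / ∑' x, balanceWeight P x := by
    intro ρ hρ x
    have h2 := hρ.isBalanced.eq_mul_balanceWeight hP
    have h3 : HasSum (fun x => ρ.real {0} * balanceWeight P x) 1 := by
      simpa only [← h2] using hρ.hasSum
    have h4 := h3.unique (hs.hasSum.mul_left (ρ.real {0}))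
    rw [h2 x, eq_div_iff hZ.ne', mul_right_comm, ← h4, one_mul]
  have hμ := hw.isReversibleLaw hP h1
  have := hν.isProbabilityMeasure
  have := hμ.isProbabilityMeasure
  refine Measure.ext_of_singleton fun x => ?_
  rw [← measureReal_eq_measureReal_iff, hu ν hν, hu _ hμ]

variable [IsMarkovKernel P]

/-- The Dirichlet form of a reversible birth and death chain. -/
lemma IsBirthDeath.hasSum_dirichlet (hP : IsBirthDeath P) (hπ : IsReversibleLaw P π) {f : ℕ → ℝ}
    (hf : MemLp f 2 π) :
    HasSum (fun x => birthProb P x * π.real {x} * (f (x + 1) - f x) ^ 2)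
      (∫ x, f x ^ 2 ∂π - ∫ x, transOp P f x * f x ∂π) := by
  have := hπ.isProbabilityMeasure
  have hw := hπ.isBalanced
  have hA := hasSum_integral_nat hf.integrable_sq
  have hwx : ∀ x, 0 ≤ π.real {x} := fun x => (hw.pos x).le
  have hp := fun x => (hP.birthProb_pos x).le
  have hq := deathProb_nonneg P
  have hpq := hP.birthProb_add_deathProb
  have hU : Summable fun x => birthProb P x * π.real {x} * f x ^ 2 := by
    refine Summable.of_nonneg_of_le (fun x => ?_) (fun x => ?_) hA.summable
    · exact mul_nonneg (mul_nonneg (hp x) (hwx x)) (sq_nonneg _)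
    · have h1 : birthProb P x ≤ 1 := by linarith [hpq x, hq x]
      have h2 := mul_nonneg (hwx x) (sq_nonneg (f x))
      nlinarith
  have hV : Summable fun x => deathProb P x * π.real {x} * f x ^ 2 := by
    refine (hA.summable.sub hU).congr fun x => ?_
    linear_combination (- π.real {x} * f x ^ 2) * hpq x
  obtain ⟨u, hu⟩ := hU
  obtain ⟨v, hv⟩ := hV
  have huv : ∫ x, f x ^ 2 ∂π = u + v := by
    refine hA.unique ((hu.add hv).congr_fun fun x => ?_)
    linear_combination (- π.real {x} * f x ^ 2) * hpq x
  -- Detailed balance turns the death terms at `x + 1` into birth terms at `x`; the term lost in the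
  -- shift is zero because `deathProb P 0 = 0`.
  have hv' : HasSum (fun x => birthProb P x * π.real {x} * f (x + 1) ^ 2) v := by
    have h := (hasSum_nat_add_iff (f := fun x => deathProb P x * π.real {x} * f x ^ 2)
      (g := v) 1).2 (by simpa [hP.deathProb_zero] using hv)
    refine h.congr_fun fun x => ?_
    rw [hw.balance x]
  have hX : Summable fun x => birthProb P x * π.real {x} * (f x * f (x + 1)) := by
    refine Summable.of_norm_bounded (hu.add hv').summable fun x => ?_
    have h0 := mul_nonneg (hp x) (hwx x)
    rw [Real.norm_eq_abs, abs_mul, abs_of_nonneg h0, ← mul_add]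
    refine mul_le_mul_of_nonneg_left ?_ h0
    rw [abs_le]
    constructor <;> nlinarith [sq_nonneg (f x - f (x + 1)), sq_nonneg (f x + f (x + 1)),
      sq_nonneg (f x), sq_nonneg (f (x + 1))]
  obtain ⟨s, hs⟩ := hX
  have hs' : HasSum (fun x => deathProb P x * π.real {x} * (f (x - 1) * f x)) s := by
    have h := (hasSum_nat_add_iff
      (f := fun x => deathProb P x * π.real {x} * (f (x - 1) * f x)) (g := s) 1).1 (by
        refine hs.congr_fun fun x => ?_
        rw [hw.balance x, Nat.add_sub_cancel])
    simpa [hP.deathProb_zero] using h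
  have hPf : ∫ x, transOp P f x * f x ∂π = s + s := by
    refine hasSum_integral_of_hasSum ((hs.add hs').congr_fun fun x => ?_)
    rw [hP.transOp_eq]
    ring
  rw [hPf, huv]
  refine ((hu.add hv').sub (hs.add hs)).congr_fun fun x => ?_
  ring

/-- A weighted Hardy inequality for finite sums. -/
lemma sum_mul_sq_le_of_tail_le {w a M d g : ℕ → ℝ} {B : ℝ} (hB : 0 < B)
    (haw : ∀ x, a x ≤ w x) (hM : ∀ x, M x = w x + M (x + 1))
    (hM0 : ∀ x, 0 ≤ M x) (hMB : ∀ x, M (x + 1) ≤ B * a x) (hg0 : g 0 = 0)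
    (hd : ∀ x, g (x + 1) = g x + d x) (n : ℕ) :
    ∑ x ∈ Finset.range n, w x * g x ^ 2 ≤
      2 * B * (1 + 2 * B) * ∑ x ∈ Finset.range n, a x * d x ^ 2 := by
  have hstep : ∀ x, M (x + 1) * (g (x + 1) ^ 2 - g x ^ 2) ≤
      B * (1 + 2 * B) * (a x * d x ^ 2) + 1 / 2 * (w x * g x ^ 2) := by
    intro x
    -- Young's inequality with weight `2 * B`: after multiplication by `M (x + 1) ≤ B * a x` the
    -- term in `g x ^ 2` has coefficient at most `w x / 2`, and is absorbed on the left at the end.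
    have h1 : g (x + 1) ^ 2 - g x ^ 2 ≤ (1 + 2 * B) * d x ^ 2 + g x ^ 2 / (2 * B) := by
      rw [hd]
      have h2 : 0 ≤ (2 * B * d x - g x) ^ 2 / (2 * B) := by positivity
      have h3 : (2 * B * d x - g x) ^ 2 / (2 * B) =
          2 * B * d x ^ 2 - 2 * d x * g x + g x ^ 2 / (2 * B) := by
        field_simp
        ring
      rw [h3] at h2
      linarith [h2]
    have h4 : 0 ≤ (1 + 2 * B) * d x ^ 2 + g x ^ 2 / (2 * B) := by positivity
    calc M (x + 1) * (g (x + 1) ^ 2 - g x ^ 2)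
        ≤ M (x + 1) * ((1 + 2 * B) * d x ^ 2 + g x ^ 2 / (2 * B)) :=
          mul_le_mul_of_nonneg_left h1 (hM0 _)
      _ ≤ B * a x * ((1 + 2 * B) * d x ^ 2 + g x ^ 2 / (2 * B)) :=
          mul_le_mul_of_nonneg_right (hMB x) h4
      _ = B * (1 + 2 * B) * (a x * d x ^ 2) + 1 / 2 * (a x * g x ^ 2) := by
          field_simp
      _ ≤ _ := by
          have := mul_le_mul_of_nonneg_right (haw x) (sq_nonneg (g x))
          linarith
  -- Summation by parts with `w x = M x - M (x + 1)`; the boundary term at `0` vanishes since `g 0 =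
  -- 0`.
  have habel : ∑ x ∈ Finset.range n, w x * g x ^ 2 + M n * g n ^ 2 =
      ∑ x ∈ Finset.range n, M (x + 1) * (g (x + 1) ^ 2 - g x ^ 2) := by
    induction n with
    | zero => simp [hg0]
    | succ n ih =>
      rw [Finset.sum_range_succ, Finset.sum_range_succ, ← ih, hM n]
      ring
  have h5 := Finset.sum_le_sum fun x (_ : x ∈ Finset.range n) => hstep x
  rw [← habel, Finset.sum_add_distrib, ← Finset.mul_sum, ← Finset.mul_sum] at h5
  have h6 : 0 ≤ M n * g n ^ 2 := mul_nonneg (hM0 n) (sq_nonneg _)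
  linarith

/-- A birth and death chain whose reversible law has tails comparable to its conductances has the
spectral gap property. -/
theorem IsBirthDeath.hasSpectralGap (hP : IsBirthDeath P) (hπ : IsReversibleLaw P π) {B : ℝ}
    (hB : ∀ x, π.real (Set.Ioi x) ≤ B * (birthProb P x * π.real {x})) : HasSpectralGap P π := by
  have := hπ.isProbabilityMeasure
  have hw := hπ.isBalanced
  have hsum := hπ.hasSum.summable
  have ha : ∀ x, 0 < birthProb P x * π.real {x} := fun x =>
    mul_pos (hP.birthProb_pos x) (hw.pos x)
  -- Enlarging `B` to at least `1` gives `K ≥ 1`, so that `1 - 1 / K ≥ 0`, as `Real.sSup_le`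
  -- requires.
  have hB1 : (0 : ℝ) < |B| + 1 := by positivity
  have hBB : ∀ x, π.real (Set.Ioi x) ≤ (|B| + 1) * (birthProb P x * π.real {x}) := fun x =>
    (hB x).trans (mul_le_mul_of_nonneg_right (by linarith [le_abs_self B]) (ha x).le)
  set D := |B| + 1
  set K := 2 * D * (1 + 2 * D)
  have hK : 0 < K := by positivity
  have hK1 : 1 ≤ K := by
    have : 1 ≤ D := le_add_of_nonneg_left (abs_nonneg B)
    nlinarith
  refine lt_of_le_of_lt (Real.sSup_le (a := 1 - 1 / K) ?_ ?_) (sub_lt_self 1 (by positivity))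
  swap
  · rw [sub_nonneg, div_le_one hK]; exact hK1
  rintro r ⟨f, hf, hf0, hf1, rfl⟩
  have hE := hP.hasSum_dirichlet hπ hf
  rw [hf1] at hE
  have hfi : Integrable f π := hf.integrable one_le_two
  have hgi : Integrable (fun x => (f x - f 0) ^ 2) π :=
    (hf.sub (memLp_const (f 0))).integrable_sq
  have hg := hasSum_integral_nat hgi
  -- Hardy's inequality needs a function vanishing at `0`. As `f` has mean zero, subtracting `f 0`
  -- can only increase the norm.
  have hval : ∫ x, (f x - f 0) ^ 2 ∂π = 1 + f 0 ^ 2 := by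
    have h1 : ∀ x, (f x - f 0) ^ 2 = f x ^ 2 - 2 * f 0 * f x + f 0 ^ 2 := fun x => by ring
    simp only [h1]
    have h2 : Integrable (fun x => 2 * f 0 * f x) π := hfi.const_mul _
    have h3 : Integrable (fun x => f x ^ 2 - 2 * f 0 * f x) π := hf.integrable_sq.sub h2
    rw [integral_add h3 (integrable_const _), integral_sub hf.integrable_sq h2,
      integral_const_mul, hf0, hf1]
    simp
  rw [hval] at hg
  have hbound : 1 + f 0 ^ 2 ≤ K * (1 - ∫ x, transOp P f x * f x ∂π) := by
    refine hg.summable.tsum_le_of_sum_range_le (fun n => ?_) |> (hg.tsum_eq ▸ ·)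
    refine (sum_mul_sq_le_of_tail_le (w := fun x => π.real {x})
      (a := fun x => birthProb P x * π.real {x})
      (M := fun x => ∑' k, π.real {k + x}) (d := fun x => f (x + 1) - f x)
      (g := fun x => f x - f 0) hB1 (fun x => ?_)
      (fun x => ?_) (fun x => tsum_nonneg fun k => (hw.pos _).le)
      (fun x => (real_Ioi_eq_tsum x).symm.trans_le (hBB x)) (by simp)
      (fun x => by ring) n).trans ?_
    · have h1 : birthProb P x ≤ 1 := by
        linarith [hP.birthProb_add_deathProb x, deathProb_nonneg P x]
      exact mul_le_of_le_one_left (hw.pos x).le h1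
    · rw [((summable_nat_add_iff (f := fun x => π.real {x}) x).2 hsum).tsum_eq_zero_add]
      simp only [zero_add, add_assoc, add_comm 1 x]
    · refine mul_le_mul_of_nonneg_left ?_ hK.le
      exact sum_le_hasSum _ (fun x _ => mul_nonneg (ha x).le (sq_nonneg _)) hE
  have h2 : 1 / K ≤ 1 - ∫ x, transOp P f x * f x ∂π := by
    rw [div_le_iff₀ hK]
    nlinarith [sq_nonneg (f 0)]
  linarith

/-- If the conductances are not bounded below by a multiple of the tails of the reversible law,
then there is no spectral gap. -/
theorem IsBirthDeath.not_hasSpectralGap (hP : IsBirthDeath P) (hπ : IsReversibleLaw P π)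
    (h : ∀ ε : ℝ, 0 < ε → ∃ x, birthProb P x * π.real {x} ≤ ε * π.real (Set.Ioi x)) :
    ¬ HasSpectralGap P π := by
  have := hπ.isProbabilityMeasure
  have hw := hπ.isBalanced
  rw [HasSpectralGap, not_lt]
  refine le_of_forall_pos_le_add fun ε hε => ?_
  -- The Dirichlet form of the test function will be `a x / (t * (1 - t))`; the factor `π.real {0}`
  -- compensates `1 - t`, which is at least that large.
  obtain ⟨x, hx⟩ := h (ε * π.real {0}) (mul_pos hε (hw.pos 0))
  set t := π.real (Set.Ioi x) with ht
  have ht0 : 0 < t := (hw.pos (x + 1)).trans_le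
    (measureReal_mono (by simp) (measure_ne_top _ _))
  have ht1 : π.real {0} ≤ 1 - t := by
    have h1 : π.real ({0} ∪ Set.Ioi x) = π.real {0} + t :=
      measureReal_union (by simp) MeasurableSet.of_discrete
    have h2 := measureReal_le_one (μ := π) (s := {0} ∪ Set.Ioi x)
    linarith
  have hpos : 0 < t * (1 - t) := mul_pos ht0 ((hw.pos 0).trans_le ht1)
  set s := √(t * (1 - t))
  have hs : 0 < s := Real.sqrt_pos.2 hpos
  have hss : s ^ 2 = t * (1 - t) := Real.sq_sqrt hpos.le
  set I : ℕ → ℝ := (Set.Ioi x).indicator 1 with hI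
  have hIm : MemLp I 2 π := (memLp_const (1 : ℝ)).indicator MeasurableSet.of_discrete
  have hIi : Integrable I π := hIm.integrable one_le_two
  have hIint : ∫ y, I y ∂π = t := integral_indicator_one MeasurableSet.of_discrete
  let f : ℕ → ℝ := fun y => s⁻¹ * (I y - t)
  have hf : MemLp f 2 π := (hIm.sub (memLp_const t)).const_mul s⁻¹
  have hf0 : ∫ y, f y ∂π = 0 := by
    simp only [f]
    rw [integral_const_mul, integral_sub hIi (integrable_const _), hIint]
    simp
  have hf1 : ∫ y, f y ^ 2 ∂π = 1 := by
    have h1 : ∀ y, f y ^ 2 = (s ^ 2)⁻¹ * ((1 - 2 * t) * I y + t ^ 2) := fun y => by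
      have h2 : I y ^ 2 = I y := by
        simp only [hI, Set.indicator_apply]; split_ifs <;> simp
      simp only [f, mul_pow, inv_pow]
      linear_combination (s ^ 2)⁻¹ * h2
    simp only [h1]
    rw [integral_const_mul, integral_add (hIi.const_mul _) (integrable_const _),
      integral_const_mul, hIint, hss]
    simp only [integral_const, probReal_univ, one_smul]
    rw [inv_mul_eq_one₀ hpos.ne']
    ring
  have hE := hP.hasSum_dirichlet hπ hf
  -- `f` jumps only across the edge from `x` to `x + 1`.
  have hE' : HasSum (fun y => birthProb P y * π.real {y} * (f (y + 1) - f y) ^ 2)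
      (birthProb P x * π.real {x} * (f (x + 1) - f x) ^ 2) := by
    refine hasSum_single x fun y hy => ?_
    have : f (y + 1) = f y := by
      simp only [f, hI, Set.indicator_apply, Set.mem_Ioi]
      have : x < y + 1 ↔ x < y := by omega
      simp [this]
    simp [this]
  have heq := hE.unique hE'
  have hfx : (f (x + 1) - f x) ^ 2 = (t * (1 - t))⁻¹ := by
    rw [← hss, ← inv_pow]
    have h1 : I (x + 1) = 1 := Set.indicator_of_mem (by simp) _
    have h2 : I x = 0 := Set.indicator_of_notMem (by simp) _
    simp only [f, h1, h2]
    ring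
  rw [hf1, hfx, ← div_eq_mul_inv] at heq
  have hle : birthProb P x * π.real {x} / (t * (1 - t)) ≤ ε := by
    rw [div_le_iff₀ hpos]
    refine hx.trans ?_
    rw [mul_assoc, mul_comm (π.real {0})]
    exact mul_le_mul_of_nonneg_left (mul_le_mul_of_nonneg_left ht1 ht0.le) hε.le
  -- A real `sSup` dominates the elements only of a bounded set; the bound `1` is the nonnegativity
  -- of the Dirichlet form.
  have hbdd : BddAbove {r : ℝ | ∃ f : ℕ → ℝ, MemLp f 2 π ∧ ∫ x, f x ∂π = 0 ∧
      ∫ x, f x ^ 2 ∂π = 1 ∧ r = ∫ x, transOp P f x * f x ∂π} := by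
    refine ⟨1, ?_⟩
    rintro r ⟨g, hg, -, hg1, rfl⟩
    have h1 := (hP.hasSum_dirichlet hπ hg).nonneg fun y =>
      mul_nonneg (mul_nonneg (hP.birthProb_pos y).le (hw.pos y).le) (sq_nonneg _)
    rw [hg1] at h1
    linarith
  have hmem : ∫ y, transOp P f y * f y ∂π ≤ lambdaOne P π :=
    le_csSup hbdd ⟨f, hf, hf0, hf1, rfl⟩
  linarith

end Reversible

/-! ### Growth of the weights in the three regimes -/

section Asymptotics

variable {P : Kernel ℕ ℕ} {w : ℕ → ℝ}

lemma IsBalanced.succ_eq (hP : IsBirthDeath P) (hw : IsBalanced P w) (x : ℕ) :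
    w (x + 1) = birthProb P x / deathProb P (x + 1) * w x := by
  rw [div_mul_eq_mul_div, hw.balance x, mul_div_cancel_left₀ _ (hP.deathProb_succ_pos x).ne']

/-- Kummer's convergence test. -/
lemma summable_of_eventually_le_sub {u B : ℕ → ℝ} (hu : ∀ x, 0 ≤ u x) (hB : ∀ x, 0 ≤ B x)
    (h : ∀ᶠ x in atTop, u x ≤ B x - B (x + 1)) : Summable u := by
  obtain ⟨N, hN⟩ := eventually_atTop.1 h
  refine (summable_nat_add_iff N).1 ?_
  refine summable_of_sum_range_le (c := B N) (fun k => hu _) fun n => ?_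
  have : ∑ k ∈ Finset.range n, u (k + N) ≤ B N - B (n + N) := by
    induction n with
    | zero => simp
    | succ n ih =>
      rw [Finset.sum_range_succ, add_right_comm n 1 N]
      linarith [hN (n + N) (by omega)]
  linarith [hB (n + N)]

section Geometric

variable {r : ℝ} {N : ℕ}

lemma le_pow_mul_of_succ_le (hr : 0 ≤ r) (h : ∀ x, N ≤ x → w (x + 1) ≤ r * w x) {x : ℕ}
    (hx : N ≤ x) (k : ℕ) : w (k + x) ≤ r ^ k * w x := by
  induction k with
  | zero => simp
  | succ k ih =>
    rw [add_right_comm k 1 x, pow_succ']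
    calc w (k + x + 1) ≤ r * w (k + x) := h _ (by omega)
      _ ≤ r * (r ^ k * w x) := mul_le_mul_of_nonneg_left ih hr
      _ = r * r ^ k * w x := by ring

lemma summable_of_succ_le (hw : ∀ x, 0 ≤ w x) (hr : 0 ≤ r) (hr1 : r < 1)
    (h : ∀ x, N ≤ x → w (x + 1) ≤ r * w x) : Summable w := by
  refine (summable_nat_add_iff N).1 ?_
  exact Summable.of_nonneg_of_le (fun k => hw _) (fun k => le_pow_mul_of_succ_le hr h le_rfl k)
    ((summable_geometric_of_lt_one hr hr1).mul_right _)

lemma tsum_tail_le_of_succ_le (hw : ∀ x, 0 ≤ w x) (hr : 0 ≤ r) (hr1 : r < 1)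
    (h : ∀ x, N ≤ x → w (x + 1) ≤ r * w x) {x : ℕ} (hx : N ≤ x) :
    ∑' k, w (k + x) ≤ (1 - r)⁻¹ * w x := by
  have hs := (summable_nat_add_iff x).2 (summable_of_succ_le hw hr hr1 h)
  have hg := (hasSum_geometric_of_lt_one hr hr1).mul_right (w x)
  rw [← hg.tsum_eq]
  exact hs.tsum_le_tsum (fun k => le_pow_mul_of_succ_le hr h hx k) hg.summable

end Geometric

/-- If `p < q` the weights decay geometrically. -/
lemma IsBalanced.exists_geometric (hP : IsBirthDeath P) (hw : IsBalanced P w) {p q : ℝ}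
    (hp : Tendsto (birthProb P) atTop (𝓝 p)) (hq : Tendsto (deathProb P) atTop (𝓝 q))
    (hpq : p < q) : ∃ r : ℝ, 0 ≤ r ∧ r < 1 ∧ ∃ N, ∀ x, N ≤ x → w (x + 1) ≤ r * w x := by
  have hp0 : 0 ≤ p := ge_of_tendsto' hp fun x => (hP.birthProb_pos x).le
  have hq0 : 0 < q := hp0.trans_lt hpq
  have hlim := hp.div (hq.comp (tendsto_add_atTop_nat 1)) hq0.ne'
  obtain ⟨r, hr1, hr2⟩ := exists_between ((div_lt_one hq0).2 hpq)
  obtain ⟨N, hN⟩ := eventually_atTop.1 (hlim.eventually (gt_mem_nhds hr1))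
  refine ⟨r, (div_nonneg hp0 hq0.le).trans hr1.le, hr2, N, fun x hx => ?_⟩
  rw [hw.succ_eq hP]
  exact mul_le_mul_of_nonneg_right (hN x hx).le (hw.pos x).le

lemma exists_forall_le_mul_of_eventually {u v : ℕ → ℝ} (hv : ∀ x, 0 < v x) {B : ℝ}
    (h : ∀ᶠ x in atTop, u x ≤ B * v x) : ∃ B' : ℝ, ∀ x, u x ≤ B' * v x := by
  obtain ⟨N, hN⟩ := eventually_atTop.1 h
  refine ⟨|B| + ∑ x ∈ Finset.range N, |u x / v x|, fun x => ?_⟩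
  have hs : 0 ≤ ∑ x ∈ Finset.range N, |u x / v x| := Finset.sum_nonneg fun _ _ => abs_nonneg _
  rcases lt_or_ge x N with hx | hx
  · rw [← div_le_iff₀ (hv x)]
    have h1 := Finset.single_le_sum (f := fun x => |u x / v x|) (fun _ _ => abs_nonneg _)
      (Finset.mem_range.2 hx)
    linarith [le_abs_self (u x / v x), abs_nonneg B]
  · refine (hN x hx).trans (mul_le_mul_of_nonneg_right ?_ (hv x).le)
    linarith [le_abs_self B]

theorem IsBirthDeath.hasSpectralGap_of_tendsto [IsMarkovKernel P] (hP : IsBirthDeath P)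
    {π : Measure ℕ} (hπ : IsReversibleLaw P π) {p q : ℝ} (hp : Tendsto (birthProb P) atTop (𝓝 p))
    (hq : Tendsto (deathProb P) atTop (𝓝 q)) (hpq : p < q) : HasSpectralGap P π := by
  have := hπ.isProbabilityMeasure
  have hw := hπ.isBalanced
  obtain ⟨r, hr0, hr1, N, hN⟩ := hw.exists_geometric hP hp hq hpq
  have hq0 : 0 < q := (ge_of_tendsto' hp fun x => (hP.birthProb_pos x).le).trans_lt hpq
  have hqev := (hq.comp (tendsto_add_atTop_nat 1)).eventually (lt_mem_nhds (half_lt_self hq0))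
  obtain ⟨B, hB⟩ := exists_forall_le_mul_of_eventually (u := fun x => π.real (Set.Ioi x))
    (v := fun x => birthProb P x * π.real {x}) (B := (1 - r)⁻¹ * (q / 2)⁻¹)
    (fun x => mul_pos (hP.birthProb_pos x) (hw.pos x)) (by
      filter_upwards [eventually_ge_atTop N, hqev] with x hx hqx
      rw [real_Ioi_eq_tsum]
      refine (tsum_tail_le_of_succ_le (fun x => (hw.pos x).le) hr0 hr1 hN
        (by omega : N ≤ x + 1)).trans ?_
      -- The conductance is written from the death side: `p` may be `0`, but death probabilities
      -- eventually exceed `q / 2 > 0`.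
      rw [hw.balance x, mul_assoc]
      refine mul_le_mul_of_nonneg_left ?_ (inv_nonneg.2 (sub_nonneg.2 hr1.le))
      rw [le_inv_mul_iff₀ (half_pos hq0)]
      exact mul_le_mul_of_nonneg_right hqx.le (hw.pos _).le)
  exact hP.hasSpectralGap hπ hB

lemma HasDriftOfOrder.exists_bounds {c : ℕ → ℝ} {α : ℝ} (h : HasDriftOfOrder P c α) :
    ∃ A B : ℝ, 0 < A ∧ ∀ᶠ x : ℕ in atTop,
      0 < x ∧ A * (x : ℝ) ^ (-α) ≤ c x ∧ c x ≤ B * (x : ℝ) ^ (-α) := by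
  obtain ⟨A, hA0, hA⟩ := EReal.lt_iff_exists_real_btwn.1 h.liminf_pos
  obtain ⟨B, hB, -⟩ := EReal.lt_iff_exists_real_btwn.1 h.limsup_lt_top
  refine ⟨A, B, by exact_mod_cast hA0, ?_⟩
  filter_upwards [eventually_lt_of_lt_liminf hA, eventually_lt_of_limsup_lt hB,
    eventually_gt_atTop 0] with x h1 h2 hx
  have hx' : (0 : ℝ) < x := by exact_mod_cast hx
  have hpos : 0 < (x : ℝ) ^ α := Real.rpow_pos_of_pos hx' α
  have h1' : A < c x * (x : ℝ) ^ α := by exact_mod_cast h1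
  have h2' : c x * (x : ℝ) ^ α < B := by exact_mod_cast h2
  refine ⟨hx, ?_, ?_⟩
  · rw [Real.rpow_neg hx'.le, ← div_eq_mul_inv, div_le_iff₀ hpos]
    exact h1'.le
  · rw [Real.rpow_neg hx'.le, ← div_eq_mul_inv, le_div_iff₀ hpos]
    exact h2'.le

lemma HasDriftOfOrder.tendsto_zero {c : ℕ → ℝ} {α : ℝ} (h : HasDriftOfOrder P c α)
    (hα : 0 < α) : Tendsto c atTop (𝓝 0) := by
  obtain ⟨A, B, hA, hAB⟩ := h.exists_bounds
  have h0 : Tendsto (fun x : ℕ => (x : ℝ) ^ (-α)) atTop (𝓝 0) :=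
    (tendsto_rpow_neg_atTop hα).comp tendsto_natCast_atTop_atTop
  refine tendsto_of_tendsto_of_tendsto_of_le_of_le' (by simpa using h0.const_mul A)
    (by simpa using h0.const_mul B) ?_ ?_
  · filter_upwards [hAB] with x hx using hx.2.1
  · filter_upwards [hAB] with x hx using hx.2.2

/-- As `α < 1`, eventually `c x ≥ 1 / x`, which gives `w (x + 1) ≤ (1 - 2 / x) * w x`. Then `x * w
x` drops by at least `w x` at each step, and Kummer's test applies. -/
lemma HasDriftOfOrder.summable_weight {c : ℕ → ℝ} {α : ℝ} (hw : IsBalanced P w)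
    (h : HasDriftOfOrder P c α) (hα : α < 1) : Summable w := by
  obtain ⟨A, B, hA, hAB⟩ := h.exists_bounds
  have hlarge : ∀ᶠ x : ℕ in atTop, 1 / A ≤ (x : ℝ) ^ (1 - α) :=
    ((tendsto_rpow_atTop (sub_pos.2 hα)).comp tendsto_natCast_atTop_atTop).eventually_ge_atTop _
  refine summable_of_eventually_le_sub (B := fun x => x * w x) (fun x => (hw.pos x).le)
    (fun x => mul_nonneg (Nat.cast_nonneg x) (hw.pos x).le) ?_
  filter_upwards [hAB, (tendsto_add_atTop_nat 1).eventually hAB, hlarge] with x hx hx1 hl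
  have hx0 : (0 : ℝ) < x := by exact_mod_cast hx.1
  have hc : 1 / (x : ℝ) ≤ c x := by
    refine le_trans ?_ hx.2.1
    have h1 : (x : ℝ) ^ (1 - α) = x * (x : ℝ) ^ (-α) := by
      rw [sub_eq_add_neg, Real.rpow_add hx0, Real.rpow_one]
    rw [h1, div_le_iff₀ hA] at hl
    rw [div_le_iff₀ hx0]
    linarith
  have hc1 : 0 ≤ c (x + 1) := le_trans (mul_nonneg hA.le (Real.rpow_nonneg (by positivity) _))
    hx1.2.1
  have hb := hw.balance x
  rw [h.birthProb_eq x hx.1, h.deathProb_eq (x + 1) (by omega)] at hb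
  have hw1 := hw.pos (x + 1)
  have hw0 := hw.pos x
  have h2 : w (x + 1) ≤ (1 - 2 / x) * w x := by
    have h3 : 1 / 2 * w (x + 1) ≤ (1 / 2 + c (x + 1)) * w (x + 1) :=
      mul_le_mul_of_nonneg_right (by linarith) hw1.le
    have h4 : (1 / 2 - c x) * w x ≤ (1 / 2 - 1 / x) * w x :=
      mul_le_mul_of_nonneg_right (by linarith) hw0.le
    have h5 : (1 - 2 / (x : ℝ)) = 2 * (1 / 2 - 1 / x) := by ring
    rw [h5]
    linarith
  have h6 : ((x : ℝ) + 1) * w (x + 1) ≤ (x + 1) * ((1 - 2 / x) * w x) :=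
    mul_le_mul_of_nonneg_left h2 (by positivity)
  have h7 : ((x : ℝ) + 1) * ((1 - 2 / x) * w x) = x * w x - w x - 2 / x * w x := by
    field_simp
    ring
  have h8 : 0 ≤ 2 / (x : ℝ) * w x := by positivity
  push_cast
  linarith

/-- If the successive ratios of a sequence tend to `1`, its tails dominate its terms. -/
lemma eventually_mul_le_sum_range (hw : ∀ x, 0 < w x)
    (h : Tendsto (fun x => w (x + 1) / w x) atTop (𝓝 1)) (L : ℕ) :
    ∀ᶠ x in atTop, (L / 2 : ℝ) * w x ≤ ∑ k ∈ Finset.range L, w (k + x) := by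
  have hk : ∀ k, Tendsto (fun x => w (k + x) / w x) atTop (𝓝 1) := by
    intro k
    induction k with
    | zero =>
      refine tendsto_const_nhds.congr fun x => ?_
      rw [zero_add, div_self (hw x).ne']
    | succ k ih =>
      have h1 := (h.comp (tendsto_add_atTop_nat k)).mul ih
      rw [one_mul] at h1
      refine h1.congr fun x => ?_
      simp only [Function.comp_apply]
      rw [add_comm x k, add_right_comm k 1 x, div_mul_div_cancel₀ (hw _).ne']
  have hall : ∀ᶠ x in atTop, ∀ k ∈ Finset.range L, 1 / 2 < w (k + x) / w x :=
    (Finset.eventually_all _).2 fun k _ => (hk k).eventually (lt_mem_nhds (by norm_num))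
  filter_upwards [hall] with x hx
  have : ∑ k ∈ Finset.range L, 1 / 2 * w x ≤ ∑ k ∈ Finset.range L, w (k + x) :=
    Finset.sum_le_sum fun k hkL => ((lt_div_iff₀ (hw x)).1 (hx k hkL)).le
  refine le_trans (le_of_eq ?_) this
  rw [Finset.sum_const, Finset.card_range, nsmul_eq_mul]
  ring

/-- Since `c → 0`, the ratios of `π` tend to `1`, so for every `L` the tail beyond some `x` exceeds
`L / 2` times `π.real {x + 1}`, while the conductance at `x` is at most `π.real {x + 1}`. -/
theorem HasDriftOfOrder.not_hasSpectralGap [IsMarkovKernel P] {c : ℕ → ℝ} {α : ℝ}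
    (hP : IsBirthDeath P) {π : Measure ℕ} (hπ : IsReversibleLaw P π)
    (h : HasDriftOfOrder P c α) (hα : 0 < α) :
    ¬ HasSpectralGap P π := by
  have := hπ.isProbabilityMeasure
  have hw := hπ.isBalanced
  have hc := h.tendsto_zero hα
  have hratio : Tendsto (fun x => π.real {x + 1} / π.real {x}) atTop (𝓝 1) := by
    have h1 : Tendsto (fun x => (1 / 2 - c x) / (1 / 2 + c (x + 1))) atTop
        (𝓝 ((1 / 2 - 0) / (1 / 2 + 0))) :=
      (hc.const_sub _).div ((hc.comp (tendsto_add_atTop_nat 1)).const_add _) (by norm_num)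
    rw [sub_zero, add_zero, div_self (by norm_num)] at h1
    refine h1.congr' ?_
    filter_upwards [eventually_ge_atTop 1] with x hx
    rw [← h.birthProb_eq x hx, ← h.deathProb_eq (x + 1) (by omega), hw.succ_eq hP x,
      mul_div_cancel_right₀ _ (hw.pos x).ne']
  refine hP.not_hasSpectralGap hπ fun ε hε => ?_
  obtain ⟨L, hL⟩ := exists_nat_ge (2 / ε)
  obtain ⟨x, hx⟩ := ((tendsto_add_atTop_nat 1).eventually
    (eventually_mul_le_sum_range hw.pos hratio L)).exists
  refine ⟨x, ?_⟩
  have hs := (summable_nat_add_iff (f := fun x => π.real {x}) (x + 1)).2 hπ.hasSum.summable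
  have h1 := hx.trans (hs.sum_le_tsum (Finset.range L) fun k _ => (hw.pos _).le)
  rw [← real_Ioi_eq_tsum] at h1
  have hq : deathProb P (x + 1) ≤ 1 := by
    linarith [hP.birthProb_add_deathProb (x + 1), hP.birthProb_pos (x + 1)]
  have h2 : 1 ≤ ε * (L / 2) := by
    rw [div_le_iff₀ hε] at hL
    linarith
  rw [hw.balance x]
  calc deathProb P (x + 1) * π.real {x + 1} ≤ 1 * π.real {x + 1} :=
        mul_le_mul_of_nonneg_right hq (hw.pos _).le
    _ ≤ ε * (L / 2) * π.real {x + 1} := mul_le_mul_of_nonneg_right h2 (hw.pos _).le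
    _ = ε * (L / 2 * π.real {x + 1}) := mul_assoc _ _ _
    _ ≤ ε * π.real (Set.Ioi x) := mul_le_mul_of_nonneg_left h1 hε.le

/-- For a summable drift the conductances are bounded above and bounded away from `0`. -/
lemma HasDriftOfOrder.exists_conductance_bounds {c : ℕ → ℝ} {α : ℝ} (hP : IsBirthDeath P)
    (hw : IsBalanced P w) (h : HasDriftOfOrder P c α) (hα : 1 < α) :
    ∃ b : ℝ, 0 < b ∧ ∀ᶠ x in atTop, b / 2 ≤ birthProb P x * w x ∧ birthProb P x * w x ≤ b := by
  obtain ⟨A, B, hA, hAB⟩ := h.exists_bounds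
  have hc0 : ∀ᶠ x in atTop, 0 ≤ c x := by
    filter_upwards [hAB] with x hx
    exact (mul_nonneg hA.le (Real.rpow_nonneg (Nat.cast_nonneg x) _)).trans hx.2.1
  have hcs : Summable c := by
    refine Summable.of_norm_bounded_eventually_nat
      (g := fun x : ℕ => B * (x : ℝ) ^ (-α)) ?_ ?_
    · exact (Real.summable_nat_rpow.2 (by linarith)).mul_left B
    · filter_upwards [hAB, hc0] with x hx h0
      rw [Real.norm_of_nonneg h0]
      exact hx.2.2
  have htail := (tendsto_sum_nat_add c).comp (tendsto_add_atTop_nat 1)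
  obtain ⟨N₀, hN₀⟩ := eventually_atTop.1 hc0
  -- A tail of `c` below `1 / 8` gives `1 - 4 * ∑ c ≥ 1 / 2`, the factor in the lower bound.
  obtain ⟨N, hN8, hNN⟩ := ((htail.eventually (gt_mem_nhds (by norm_num : (0 : ℝ) < 1 / 8))).and
    (eventually_ge_atTop N₀)).exists
  simp only [Function.comp_apply] at hN8
  have ha : ∀ x, 0 < birthProb P x * w x := fun x => mul_pos (hP.birthProb_pos x) (hw.pos x)
  -- By balance, successive conductances have ratio `(1 / 2 - c) / (1 / 2 + c)` with `c` taken at `x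
  -- + 1`, which lies between `1 - 4 * c` and `1`.
  have hstep : ∀ x, N ≤ x → birthProb P (x + 1) * w (x + 1) ≤ birthProb P x * w x ∧
      (1 - 4 * c (x + 1)) * (birthProb P x * w x) ≤ birthProb P (x + 1) * w (x + 1) := by
    intro x hx
    have hc := hN₀ (x + 1) (by omega)
    have hw1 := hw.pos (x + 1)
    rw [hw.balance x, h.birthProb_eq (x + 1) (by omega), h.deathProb_eq (x + 1) (by omega),
      ← mul_assoc]
    constructor
    · exact mul_le_mul_of_nonneg_right (by linarith) hw1.le
    · refine mul_le_mul_of_nonneg_right ?_ hw1.le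
      nlinarith [sq_nonneg (c (x + 1))]
  -- The lower bound is the inequality `∏ (1 - u) ≥ 1 - ∑ u`, run with the upper bound `a (n + N) ≤
  -- a N` so that no sign of `1 - 4 * c` is needed.
  have hind : ∀ n, birthProb P (n + N) * w (n + N) ≤ birthProb P N * w N ∧
      (1 - 4 * ∑ k ∈ Finset.range n, c (k + (N + 1))) * (birthProb P N * w N) ≤
        birthProb P (n + N) * w (n + N) := by
    intro n
    induction n with
    | zero => simp
    | succ n ih =>
      obtain ⟨h1, h2⟩ := hstep (n + N) (by omega)
      rw [add_right_comm n 1 N, Finset.sum_range_succ]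
      refine ⟨h1.trans ih.1, le_trans ?_ h2⟩
      have hc := hN₀ (n + N + 1) (by omega)
      have h3 := mul_le_mul_of_nonneg_left ih.1 hc
      rw [← add_assoc n N 1]
      nlinarith [ih.2]
  refine ⟨birthProb P N * w N, ha N, ?_⟩
  filter_upwards [eventually_ge_atTop N] with x hx
  obtain ⟨n, rfl⟩ := Nat.exists_eq_add_of_le' hx
  refine ⟨le_trans ?_ (hind n).2, (hind n).1⟩
  have hsum : ∑ k ∈ Finset.range n, c (k + (N + 1)) ≤ ∑' k, c (k + (N + 1)) :=
    ((summable_nat_add_iff (N + 1)).2 hcs).sum_le_tsum _ fun k _ => hN₀ _ (by omega)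
  rw [div_eq_inv_mul]
  exact mul_le_mul_of_nonneg_right (by linarith) (ha N).le

lemma HasDriftOfOrder.not_summable_weight [IsMarkovKernel P] {c : ℕ → ℝ} {α : ℝ}
    (hP : IsBirthDeath P) (hw : IsBalanced P w) (h : HasDriftOfOrder P c α) (hα : 1 < α) :
    ¬ Summable w := by
  intro hs
  obtain ⟨b, hb, hbd⟩ := h.exists_conductance_bounds hP hw hα
  obtain ⟨x, h1, h2⟩ := (hbd.and
    (hs.tendsto_atTop_zero.eventually (gt_mem_nhds (half_pos hb)))).exists
  have hp : birthProb P x ≤ 1 := by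
    linarith [hP.birthProb_add_deathProb x, deathProb_nonneg P x]
  have := mul_le_of_le_one_left (hw.pos x).le hp
  linarith [h1.1]

lemma HasDriftOfOrder.not_summable_resistance {c : ℕ → ℝ} {α : ℝ} (hP : IsBirthDeath P)
    (hw : IsBalanced P w) (h : HasDriftOfOrder P c α) (hα : 1 < α) :
    ¬ Summable fun x => 1 / (birthProb P x * w x) := by
  intro hs
  obtain ⟨b, hb, hbd⟩ := h.exists_conductance_bounds hP hw hα
  obtain ⟨x, h1, h2⟩ := (hbd.and
    (hs.tendsto_atTop_zero.eventually (gt_mem_nhds (one_div_pos.2 hb)))).exists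
  have := one_div_le_one_div_of_le (mul_pos (hP.birthProb_pos x) (hw.pos x)) h1.2
  linarith

end Asymptotics

end MarkovChain

theorem theorem2 (P : Kernel ℕ ℕ) [IsMarkovKernel P] (hP : MarkovChain.IsBirthDeath P) :
    -- (i)
    (∀ p q : ℝ, Tendsto (MarkovChain.birthProb P) atTop (𝓝 p) →
      Tendsto (MarkovChain.deathProb P) atTop (𝓝 q) → p < q →
        MarkovChain.IsPositiveRecurrent P ∧
        (∃! π : Measure ℕ, MarkovChain.IsReversibleLaw P π) ∧
        ∀ π : Measure ℕ, MarkovChain.IsReversibleLaw P π → MarkovChain.HasSpectralGap P π) ∧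
    -- (ii)
    (∀ (c : ℕ → ℝ) (α : ℝ), MarkovChain.HasDriftOfOrder P c α → 0 < α → α < 1 →
        MarkovChain.IsPositiveRecurrent P ∧
        (∃! π : Measure ℕ, MarkovChain.IsReversibleLaw P π) ∧
        ∀ π : Measure ℕ, MarkovChain.IsReversibleLaw P π → ¬ MarkovChain.HasSpectralGap P π) ∧
    -- (iii)
    (∀ (c : ℕ → ℝ) (α : ℝ), MarkovChain.HasDriftOfOrder P c α → 1 < α →
        MarkovChain.IsRecurrent P ∧
        ∀ x, ¬ MarkovChain.IsPositiveRecurrentState P x) := by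
  have hw := hP.isBalanced_balanceWeight
  refine ⟨fun p q hp hq hpq => ?_, fun c α h h0 h1 => ?_, fun c α h h1 => ?_⟩
  · obtain ⟨r, hr0, hr1, N, hN⟩ := hw.exists_geometric hP hp hq hpq
    have hs := MarkovChain.summable_of_succ_le (fun x => (hw.pos x).le) hr0 hr1 hN
    exact ⟨hP.isPositiveRecurrent hw hs, hP.existsUnique_isReversibleLaw hs,
      fun π hπ => hP.hasSpectralGap_of_tendsto hπ hp hq hpq⟩
  · have hs := h.summable_weight hw h1
    exact ⟨hP.isPositiveRecurrent hw hs, hP.existsUnique_isReversibleLaw hs,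
      fun π hπ => h.not_hasSpectralGap hP hπ h0⟩
  · have hrec := hP.isRecurrent hw (h.not_summable_resistance hP hw h1)
    exact ⟨hrec, fun x =>
      hP.not_isPositiveRecurrentState hw (h.not_summable_weight hP hw h1) (hrec x)⟩
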